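/- Let $IR(3,\mathbb F_2)$ denote the poset, ordered by inclusion, of all subsets $E\subseteq\mathbb F_2^3\setminus\{0\}$ such that the matroid of linear independence over $\mathbb F_2$ on $E$ is a regular matroid of rank $3$, where a matroid is \emph{regular} if it is represented over $\mathbb R$ by the columns of a totally unimodular matrix. Let $|IR(3,\mathbb F_2)|$ be its geometric realization, that is, the geometric realization of the simplicial complex whose $k$-simplices are the chains $x_0<x_1<\cdots<x_k$ of the poset. \textbf{Theorem.} $|IR(3,\mathbb F_2)|$ is homotopy equivalent to a wedge of eight $3$-spheres: $$|IR(3,\mathbb F_2)|\simeq\bigvee_8 S^3 .$$ -/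

import Mathlib

open Metric

/-! ### Matroids of vectors and regular matroids -/

section Matroids

/-- Steinitz augmentation for finite linearly independent sets of vectors. -/
theorem linearIndepOn_augment {K V : Type*} [Field K] [AddCommGroup V] [Module K V]
    {I J : Set V} (hIfin : I.Finite) (hJfin : J.Finite)
    (hI : LinearIndepOn K id I) (hJ : LinearIndepOn K id J) (h : I.ncard < J.ncard) :
    ∃ e ∈ J, e ∉ I ∧ LinearIndepOn K id (insert e I) := by
  by_contra hcon
  push Not at hcon
  have hsub : J ⊆ (Submodule.span K I : Set V) := by
    intro e he
    by_cases heI : e ∈ I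
    · exact Submodule.subset_span heI
    · by_contra hspan
      exact hcon e he heI (hI.insert (by simpa using hspan))
  have hle : Submodule.span K J ≤ Submodule.span K I := Submodule.span_le.2 hsub
  have := hIfin.fintype
  have := hJfin.fintype
  have : FiniteDimensional K (Submodule.span K I) := FiniteDimensional.span_of_finite K hIfin
  have h1 := Submodule.finrank_mono hle
  rw [finrank_span_set_eq_card hJ, finrank_span_set_eq_card hI, ← Set.ncard_eq_toFinset_card',
    ← Set.ncard_eq_toFinset_card'] at h1
  omega

/-- The matroid of linear independence on a finite set `E` of vectors of a `K`-vector space `V`: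
its ground set is `E` and its independent sets are the linearly independent subsets of `E`. -/
def vectorMatroid (K : Type*) {V : Type*} [Field K] [AddCommGroup V] [Module K V]
    (E : Finset V) : Matroid V :=
  (IndepMatroid.ofFinite (E := (E : Set V)) E.finite_toSet
    (fun I => I ⊆ (E : Set V) ∧ LinearIndepOn K id I)
    ⟨Set.empty_subset _, linearIndepOn_empty K id⟩
    (fun _ _ hJ hIJ => ⟨hIJ.trans hJ.1, hJ.2.mono hIJ⟩)
    (fun _ _ hI hJ hlt => by
      obtain ⟨e, heJ, heI, he⟩ := linearIndepOn_augment (E.finite_toSet.subset hI.1)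
        (E.finite_toSet.subset hJ.1) hI.2 hJ.2 hlt
      exact ⟨e, heJ, heI, Set.insert_subset (hJ.1 heJ) hI.1, he⟩)
    (fun _ hI => hI.1)).matroid

theorem vectorMatroid_ground (K : Type*) {V : Type*} [Field K] [AddCommGroup V] [Module K V]
    (E : Finset V) : (vectorMatroid K E).E = (E : Set V) := rfl

theorem vectorMatroid_indep_iff (K : Type*) {V : Type*} [Field K] [AddCommGroup V] [Module K V]
    (E : Finset V) (I : Set V) :
    (vectorMatroid K E).Indep I ↔ I ⊆ (E : Set V) ∧ LinearIndepOn K id I := Iff.rfl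

/-- A matroid is regular if it is represented over `ℝ` by a totally unimodular matrix: the columns
of the matrix are indexed by the ground set, and a subset of the ground set is independent exactly
when the corresponding family of columns is linearly independent. -/
def IsRegularMatroid {α : Type*} (M : Matroid α) : Prop :=
  ∃ (m : ℕ) (A : Matrix (Fin m) M.E ℝ), A.IsTotallyUnimodular ∧
    ∀ I : Set M.E, M.Indep (Subtype.val '' I) ↔ LinearIndepOn ℝ A.col I

end Matroids

/-! ### The poset of regular submatroids of full rank -/

section Poset

/-- `IR r` is the poset of all subsets of `F₂ʳ ∖ {0}` which are, with linear independence over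
`F₂`, regular matroids of rank `r`. It is ordered by inclusion. -/
def IR (r : ℕ) : Type :=
  {E : Finset (Fin r → ZMod 2) // (0 : Fin r → ZMod 2) ∉ E ∧
    IsRegularMatroid (vectorMatroid (ZMod 2) E) ∧ (vectorMatroid (ZMod 2) E).eRank = r}

instance (r : ℕ) : PartialOrder (IR r) :=
  inferInstanceAs (PartialOrder {E : Finset (Fin r → ZMod 2) // (0 : Fin r → ZMod 2) ∉ E ∧
    IsRegularMatroid (vectorMatroid (ZMod 2) E) ∧ (vectorMatroid (ZMod 2) E).eRank = r})

instance (r : ℕ) : Finite (IR r) :=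
  inferInstanceAs (Finite {E : Finset (Fin r → ZMod 2) // (0 : Fin r → ZMod 2) ∉ E ∧
    IsRegularMatroid (vectorMatroid (ZMod 2) E) ∧ (vectorMatroid (ZMod 2) E).eRank = r})

noncomputable instance (r : ℕ) : Fintype (IR r) := Fintype.ofFinite _

/-- The geometric realization of a finite poset `P`, that is, of the simplicial complex whose
`k`-simplices are the chains `x₀ < x₁ < ⋯ < xₖ` in `P`. In barycentric coordinates a point is a
family of nonnegative weights with sum `1` whose support is a chain. -/
def posetRealization (P : Type*) [PartialOrder P] [Fintype P] : Set (P → ℝ) :=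
  {w | w ∈ stdSimplex ℝ P ∧ IsChain (· ≤ ·) (Function.support w)}

end Poset

/-! ### Wedges of spheres -/

section Wedges

/-- The wedge of a nonempty family of pointed spaces: the quotient of the disjoint union that
identifies all the base points with one another. -/
def Wedge {ι : Type*} [Nonempty ι] (X : ι → Type*) (x₀ : ∀ i, X i) : Type _ :=
  Quot (fun a b : (Σ i, X i) => a.2 = x₀ a.1 ∧ b.2 = x₀ b.1)

instance {ι : Type*} [Nonempty ι] (X : ι → Type*) [∀ i, TopologicalSpace (X i)]
    (x₀ : ∀ i, X i) : TopologicalSpace (Wedge X x₀) :=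
  inferInstanceAs (TopologicalSpace (Quot _))

/-- The unit sphere `Sⁿ` in `ℝⁿ⁺¹`. -/
abbrev unitSphere (n : ℕ) : Type :=
  sphere (0 : EuclideanSpace ℝ (Fin (n + 1))) 1

/-- The base point `(1, 0, …, 0)` of `Sⁿ`. -/
noncomputable def sphereBase (n : ℕ) : unitSphere n :=
  ⟨EuclideanSpace.single 0 1, by simp⟩

/-- The wedge of `k` copies of `Sⁿ`, for `k ≥ 1`. -/
abbrev WedgeOfSpheres (k n : ℕ) [NeZero k] : Type :=
  Wedge (fun _ : Fin k => unitSphere n) (fun _ => sphereBase n)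

end Wedges

/-!
A set `E` of nonzero vectors of `F₂³` belongs to `IR 3` exactly when it spans and is not the whole
Fano plane. The plane is not regular; conversely, a linear automorphism takes an omitted vector to
`(1, 1, 1)`, and the other vectors lift to the columns of a totally unimodular integral matrix.
Hence `E ↦ Eᶜ` identifies `IR 3`, with the order reversed, with the nonempty faces of the
independence complex `K` of the dual of the Fano matroid, and the realization of `IR 3` is the
barycentric subdivision of `K`.

There are eight facets of `K`, all of dimension three, such that the remaining faces of `K` become
a cone once they are thinned out by collapses, so that they form a contractible subcomplex `L`.
Since `L` is a deformation retract of a collar in `K`, `K` is homotopy equivalent to `K / L`. This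
quotient is a wedge of eight copies of a 3-simplex with its boundary collapsed to a point.
-/

/-! ### Collapsing a subspace to a point -/

section Collapse

variable {X W : Type*} [TopologicalSpace X] [TopologicalSpace W]

theorem nonempty_homotopyEquiv_of_isQuotientMap {f : X → W} (hf : Topology.IsQuotientMap f)
    {h : unitInterval × X → X} (hc : Continuous h) (h_zero : ∀ x, h (0, x) = x)
    (h_fibre : ∀ t x y, f x = f y → f (h (t, x)) = f (h (t, y)))
    (h_one : ∀ x y, f x = f y → h (1, x) = h (1, y)) :
    Nonempty (ContinuousMap.HomotopyEquiv X W) := by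
  let r : W → X := Function.surjInv hf.surjective
  have hr : ∀ w, f (r w) = w := Function.surjInv_eq hf.surjective
  let g : W → X := fun w => h (1, r w)
  have hgf : ∀ x, g (f x) = h (1, x) := fun x => h_one _ _ (hr _)
  have hg : Continuous g := by
    rw [hf.continuous_iff, show g ∘ f = fun x => h (1, x) from funext hgf]
    fun_prop
  let H : unitInterval × W → W := fun p => f (h (p.1, r p.2))
  have hH : Continuous H := by
    refine hf.continuous_lift_prod_right ?_
    rw [show (fun p : unitInterval × X => H (p.1, f p.2)) = fun p => f (h p) from
      funext fun p => h_fibre _ _ _ (hr _)]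
    exact hf.continuous.comp hc
  exact ⟨{
    toFun := ⟨f, hf.continuous⟩
    invFun := ⟨g, hg⟩
    left_inv := ⟨ContinuousMap.Homotopy.symm
      { toFun := h
        continuous_toFun := hc
        map_zero_left := h_zero
        map_one_left := fun x => (hgf x).symm }⟩
    right_inv := ⟨ContinuousMap.Homotopy.symm
      { toFun := H
        continuous_toFun := hH
        map_zero_left := fun w => by
          simp only [H, h_zero, hr, ContinuousMap.coe_id, id_eq]
        map_one_left := fun w => rfl }⟩ }⟩

/-- `f : X → W` exhibits `W` as the quotient `X / A`, with `w₀` the image of `A`. -/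
structure IsCollapse (f : X → W) (A : Set X) (w₀ : W) : Prop where
  isQuotientMap : Topology.IsQuotientMap f
  eq_base_iff : ∀ x, f x = w₀ ↔ x ∈ A
  injOn : Aᶜ.InjOn f

/-- A deformation of `X` during which every point that starts close to `A` is swallowed by `A`:
the point `x` has been swallowed at time `depth x`, which is `0` for the points of `A`. It plays
the role of an NDR pair structure, and is what is needed for `A` to have the homotopy extension
property in `X` up to homotopy. -/
structure Collar (A : Set X) where
  deformation : unitInterval × X → X
  depth : X → ℝ
  continuous_deformation : Continuous deformation
  continuous_depth : Continuous depth
  deformation_zero : ∀ x, deformation (0, x) = x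
  depth_nonneg : ∀ x, 0 ≤ depth x
  depth_eq_zero : ∀ x ∈ A, depth x = 0
  deformation_mem : ∀ (t : unitInterval) (x : X), depth x ≤ t → deformation (t, x) ∈ A

namespace IsCollapse

variable {f : X → W} {A : Set X} {w₀ : W}

theorem of_continuous [CompactSpace X] [T2Space W] (hf : Continuous f) (hs : f.Surjective)
    (hbase : ∀ x, f x = w₀ ↔ x ∈ A) (hinj : Aᶜ.InjOn f) : IsCollapse f A w₀ :=
  ⟨hf.isClosedMap.isQuotientMap hf hs, hbase, hinj⟩

theorem comp_homeomorph {X' : Type*} [TopologicalSpace X'] (hf : IsCollapse f A w₀)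
    (h : X' ≃ₜ X) : IsCollapse (f ∘ h) (h ⁻¹' A) w₀ where
  isQuotientMap := hf.isQuotientMap.comp h.isQuotientMap
  eq_base_iff x := hf.eq_base_iff (h x)
  injOn := hf.injOn.comp h.injective.injOn fun _ hx => hx

theorem eq_iff (hf : IsCollapse f A w₀) {x y : X} : f x = f y ↔ x = y ∨ x ∈ A ∧ y ∈ A := by
  refine ⟨fun h => ?_, ?_⟩
  · have hxy : x ∈ A ↔ y ∈ A := by rw [← hf.eq_base_iff, h, hf.eq_base_iff]
    by_cases hx : x ∈ A
    · exact Or.inr ⟨hx, hxy.1 hx⟩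
    · exact Or.inl (hf.injOn hx (fun hy => hx (hxy.2 hy)) h)
  · rintro (rfl | ⟨hx, hy⟩)
    · rfl
    · rw [(hf.eq_base_iff x).2 hx, (hf.eq_base_iff y).2 hy]

end IsCollapse

namespace Collar

variable {A : Set X}

/-- The homotopy of `X` that follows the deformation of a collar of `A` until a point enters `A`
and from then on a given homotopy `H` of `A`. -/
noncomputable def extend (C : Collar A) (H : unitInterval × A → A)
    (p : unitInterval × X) : X :=
  open scoped Classical in
  if h : C.depth p.2 ≤ p.1 then
    H (Set.projIcc 0 1 zero_le_one (p.1 - C.depth p.2),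
      ⟨C.deformation p, C.deformation_mem p.1 p.2 h⟩)
  else C.deformation p

variable {H : unitInterval × A → A}

theorem extend_of_le (C : Collar A) {p : unitInterval × X} (h : C.depth p.2 ≤ p.1) :
    C.extend H p = H (Set.projIcc 0 1 zero_le_one (p.1 - C.depth p.2),
      ⟨C.deformation p, C.deformation_mem p.1 p.2 h⟩) :=
  dif_pos h

theorem extend_of_ge (C : Collar A) (H_zero : ∀ a, H (0, a) = a) {p : unitInterval × X}
    (h : p.1 ≤ C.depth p.2) : C.extend H p = C.deformation p := by
  rcases h.lt_or_eq with hlt | heq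
  · exact dif_neg hlt.not_ge
  · have hproj : Set.projIcc (0 : ℝ) 1 zero_le_one (p.1 - C.depth p.2) = 0 := by
      rw [heq, sub_self, Set.projIcc_left]
      rfl
    rw [C.extend_of_le heq.ge, hproj, H_zero]

theorem continuous_extend (C : Collar A) (hH : Continuous H) (H_zero : ∀ a, H (0, a) = a) :
    Continuous (C.extend H) := by
  have hd : Continuous fun p : unitInterval × X => C.depth p.2 :=
    C.continuous_depth.comp continuous_snd
  have ht : Continuous fun p : unitInterval × X => (p.1 : ℝ) := by fun_prop
  have hle : ContinuousOn (C.extend H) {p | C.depth p.2 ≤ p.1} := by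
    rw [continuousOn_iff_continuous_domRestrict]
    refine Continuous.congr ?_ fun p => (C.extend_of_le p.2).symm
    refine continuous_subtype_val.comp (hH.comp (Continuous.prodMk ?_ ?_))
    · exact continuous_projIcc.comp ((ht.sub hd).comp continuous_subtype_val)
    · exact (C.continuous_deformation.comp continuous_subtype_val).subtype_mk _
  have hge : ContinuousOn (C.extend H) {p | p.1 ≤ C.depth p.2} :=
    C.continuous_deformation.continuousOn.congr fun p hp => C.extend_of_ge H_zero hp
  have hcover : {p : unitInterval × X | C.depth p.2 ≤ p.1} ∪ {p | p.1 ≤ C.depth p.2} =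
      Set.univ := Set.eq_univ_of_forall fun p => le_total (C.depth p.2) p.1
  rw [← continuousOn_univ, ← hcover]
  exact hle.union_of_isClosed hge (isClosed_le hd ht) (isClosed_le ht hd)

end Collar

theorem IsCollapse.nonempty_homotopyEquiv {f : X → W} {A : Set X} {w₀ : W}
    (hf : IsCollapse f A w₀) (C : Collar A) [ContractibleSpace A] :
    Nonempty (ContinuousMap.HomotopyEquiv X W) := by
  obtain ⟨a, ⟨H⟩⟩ := id_nullhomotopic A
  have extend_mem : ∀ (t : unitInterval), ∀ x ∈ A, C.extend H (t, x) ∈ A := by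
    intro t x hx
    rw [C.extend_of_le (by rw [C.depth_eq_zero x hx]; exact t.2.1)]
    exact Subtype.coe_prop _
  have extend_one : ∀ x ∈ A, C.extend H (1, x) = a := by
    intro x hx
    have hdepth := C.depth_eq_zero x hx
    rw [C.extend_of_le (by simp [hdepth])]
    simp [hdepth]
  refine nonempty_homotopyEquiv_of_isQuotientMap hf.isQuotientMap
    (C.continuous_extend H.continuous H.map_zero_left) (fun x => ?_) (fun t x y hxy => ?_)
    fun x y hxy => ?_
  · exact (C.extend_of_ge H.map_zero_left (C.depth_nonneg x)).trans (C.deformation_zero x)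
  · rcases hf.eq_iff.1 hxy with rfl | ⟨hx, hy⟩
    · rfl
    · exact hf.eq_iff.2 (Or.inr ⟨extend_mem t x hx, extend_mem t y hy⟩)
  · rcases hf.eq_iff.1 hxy with rfl | ⟨hx, hy⟩
    · rfl
    · rw [extend_one x hx, extend_one y hy]

end Collapse

/-! ### Attaching cells -/

section Cells

namespace Wedge

variable {κ : Type*} [Nonempty κ] {Y : κ → Type*} {y₀ : ∀ a, Y a}

/-- The point of a wedge given by a point of one of its summands. -/
def mk (y₀ : ∀ a, Y a) (p : Σ a, Y a) : Wedge Y y₀ :=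
  Quot.mk _ p

theorem isQuotientMap_mk [∀ a, TopologicalSpace (Y a)] : Topology.IsQuotientMap (mk y₀) :=
  isQuotientMap_quot_mk

theorem mk_eq_mk_iff {p q : Σ a, Y a} :
    mk y₀ p = mk y₀ q ↔ p = q ∨ p.2 = y₀ p.1 ∧ q.2 = y₀ q.1 := by
  refine ⟨fun h => ?_, ?_⟩
  · have hgen := Quot.eqvGen_exact h
    clear h
    induction hgen with
    | rel _ _ hrel => exact Or.inr hrel
    | refl _ => exact Or.inl rfl
    | symm _ _ _ ih => exact ih.imp Eq.symm And.symm
    | trans _ _ _ _ _ ihxy ihyz =>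
      rcases ihxy with rfl | hxy
      · exact ihyz
      · rcases ihyz with rfl | hyz
        · exact Or.inr hxy
        · exact Or.inr ⟨hxy.1, hyz.2⟩
  · rintro (rfl | h)
    · rfl
    · exact Quot.sound h

theorem mk_eq_base_iff {a b : κ} {y : Y a} : mk y₀ ⟨a, y⟩ = mk y₀ ⟨b, y₀ b⟩ ↔ y = y₀ a := by
  rw [mk_eq_mk_iff]
  refine ⟨?_, fun h => Or.inr ⟨h, rfl⟩⟩
  rintro (h | h)
  · cases h
    rfl
  · exact h.1

end Wedge

theorem isQuotientMap_sigmaMap_id {κ : Type*} {D Y : κ → Type*} [∀ a, TopologicalSpace (D a)]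
    [∀ a, TopologicalSpace (Y a)] {σ : ∀ a, D a → Y a}
    (hσ : ∀ a, Topology.IsQuotientMap (σ a)) : Topology.IsQuotientMap (Sigma.map id σ) := by
  refine ⟨.of_isOpen_preimage_iff_isOpen fun s => ?_,
    Function.surjective_id.sigma_map fun a => (hσ a).surjective⟩
  simp only [isOpen_sigma_iff, ← (hσ _).isOpen_preimage]
  rfl

/-- `X` is obtained from its subspace `A` by attaching the cells `D a`, with characteristic maps
`cell a`: the points of `X` outside `A` come from exactly one point of one cell. -/
structure IsCellFamily {X κ : Type*} [TopologicalSpace X] {D : κ → Type*}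
    [∀ a, TopologicalSpace (D a)] (cell : ∀ a, D a → X) (A : Set X) : Prop where
  isClosed : IsClosed A
  continuous : ∀ a, Continuous (cell a)
  cover : ∀ x ∉ A, ∃ a z, cell a z = x
  inj : ∀ a b z w, cell a z = cell b w → cell a z ∉ A → (⟨a, z⟩ : Σ a, D a) = ⟨b, w⟩

namespace IsCellFamily

variable {X κ : Type*} [TopologicalSpace X] [T2Space X] [Finite κ] {D : κ → Type*}
  [∀ a, TopologicalSpace (D a)] [∀ a, CompactSpace (D a)] {cell : ∀ a, D a → X} {A : Set X}

theorem isQuotientMap (h : IsCellFamily cell A) : Topology.IsQuotientMap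
    (Sum.elim (↑) fun p => cell p.1 p.2 : A ⊕ (Σ a, D a) → X) := by
  have hcells : Continuous fun p : Σ a, D a => cell p.1 p.2 := continuous_sigma h.continuous
  refine (h.isClosed.isClosedMap_subtype_val.sumElim hcells.isClosedMap).isQuotientMap
    (continuous_subtype_val.sumElim hcells) fun x => ?_
  by_cases hx : x ∈ A
  · exact ⟨Sum.inl ⟨x, hx⟩, rfl⟩
  · obtain ⟨a, z, rfl⟩ := h.cover x hx
    exact ⟨Sum.inr ⟨a, z⟩, rfl⟩

variable [Nonempty κ] {Y : κ → Type*} [∀ a, TopologicalSpace (Y a)] {y₀ : ∀ a, Y a}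
  {σ : ∀ a, D a → Y a}

theorem exists_continuousMap_wedge (h : IsCellFamily cell A)
    (hσ : ∀ a, IsCollapse (σ a) (cell a ⁻¹' A) (y₀ a)) (b : κ) :
    ∃ f : C(X, Wedge Y y₀), (∀ x ∈ A, f x = Wedge.mk y₀ ⟨b, y₀ b⟩) ∧
      ∀ a z, f (cell a z) = Wedge.mk y₀ ⟨a, σ a z⟩ := by
  have mk_eq_base (a : κ) (z : D a) :
      Wedge.mk y₀ ⟨a, σ a z⟩ = Wedge.mk y₀ ⟨b, y₀ b⟩ ↔ cell a z ∈ A := by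
    rw [Wedge.mk_eq_base_iff]
    exact (hσ a).eq_base_iff z
  let q : C(A ⊕ (Σ a, D a), X) := ⟨Sum.elim (↑) fun p => cell p.1 p.2, h.isQuotientMap.continuous⟩
  let g : C(A ⊕ (Σ a, D a), Wedge Y y₀) :=
    ⟨Sum.elim (fun _ => Wedge.mk y₀ ⟨b, y₀ b⟩) (Wedge.mk y₀ ∘ Sigma.map id σ),
      continuous_const.sumElim (Wedge.isQuotientMap_mk.continuous.comp
        (isQuotientMap_sigmaMap_id fun a => (hσ a).isQuotientMap).continuous)⟩
  have hg : Function.FactorsThrough g q := by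
    rintro (x | ⟨a, z⟩) (y | ⟨c, w⟩) (hxy : _ = _)
    · rfl
    · exact ((mk_eq_base c w).2 (hxy.subst (motive := (· ∈ A)) x.2)).symm
    · exact (mk_eq_base a z).2 (hxy.symm.subst (motive := (· ∈ A)) y.2)
    · by_cases hz : cell a z ∈ A
      · have hw : cell c w ∈ A := hxy.subst (motive := (· ∈ A)) hz
        exact ((mk_eq_base a z).2 hz).trans ((mk_eq_base c w).2 hw).symm
      · cases h.inj a c z w hxy hz
        rfl
  have hq : Topology.IsQuotientMap q := h.isQuotientMap
  exact ⟨hq.lift g hg, fun x hx => congr($(hq.lift_comp g hg) (Sum.inl ⟨x, hx⟩)),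
    fun a z => congr($(hq.lift_comp g hg) (Sum.inr ⟨a, z⟩))⟩

theorem exists_isCollapse_wedge (h : IsCellFamily cell A)
    (hσ : ∀ a, IsCollapse (σ a) (cell a ⁻¹' A) (y₀ a)) :
    ∃ (f : X → Wedge Y y₀) (w₀ : Wedge Y y₀), IsCollapse f A w₀ := by
  obtain ⟨b⟩ := ‹Nonempty κ›
  obtain ⟨f, f_of_mem, f_cell⟩ := h.exists_continuousMap_wedge hσ b
  have hquot : Topology.IsQuotientMap (f ∘ fun p : Σ a, D a => cell p.1 p.2) := by
    rw [show f ∘ (fun p : Σ a, D a => cell p.1 p.2) = Wedge.mk y₀ ∘ Sigma.map id σ from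
      funext fun p => f_cell p.1 p.2]
    exact Wedge.isQuotientMap_mk.comp (isQuotientMap_sigmaMap_id fun a => (hσ a).isQuotientMap)
  refine ⟨f, Wedge.mk y₀ ⟨b, y₀ b⟩, .of_comp (continuous_sigma h.continuous) f.continuous hquot,
    fun x => ⟨fun hx => ?_, f_of_mem x⟩, fun x hx y hy hxy => ?_⟩
  · by_contra hxA
    obtain ⟨a, z, rfl⟩ := h.cover x hxA
    rw [f_cell, Wedge.mk_eq_base_iff] at hx
    exact hxA (((hσ a).eq_base_iff z).1 hx)
  · obtain ⟨a, z, rfl⟩ := h.cover x hx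
    obtain ⟨c, w, rfl⟩ := h.cover y hy
    rw [f_cell, f_cell, Wedge.mk_eq_mk_iff] at hxy
    rcases hxy with hxy | hxy
    · obtain ⟨rfl, hzw⟩ := Sigma.mk.inj_iff.1 hxy
      rw [(hσ a).injOn hx hy (eq_of_heq hzw)]
    · exact absurd (((hσ a).eq_base_iff z).1 hxy.1) hx

end IsCellFamily

end Cells

/-! ### Balls and simplices modulo their boundary -/

section Balls

/-- The map of the closed unit ball of `ℝⁿ` onto `Sⁿ` that wraps the ball around the sphere: it
sends the center to the antipode of the base point and the boundary to the base point. -/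
noncomputable def wrapBall {n : ℕ} (z : closedBall (0 : EuclideanSpace ℝ (Fin n)) 1) :
    unitSphere n :=
  ⟨WithLp.toLp 2 (Fin.cons (2 * ‖z.1‖ ^ 2 - 1) fun i => 2 * √(1 - ‖z.1‖ ^ 2) * z.1 i), by
    have hz : ‖z.1‖ ≤ 1 := mem_closedBall_zero_iff.1 z.2
    have hsqrt : √(1 - ‖z.1‖ ^ 2) ^ 2 = 1 - ‖z.1‖ ^ 2 :=
      Real.sq_sqrt (by nlinarith [norm_nonneg z.1])
    rw [mem_sphere_zero_iff_norm, ← sq_eq_sq₀ (norm_nonneg _) zero_le_one,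
      EuclideanSpace.real_norm_sq_eq, Fin.sum_univ_succ]
    simp only [Fin.cons_zero, Fin.cons_succ, mul_pow, hsqrt, ← Finset.mul_sum,
      ← EuclideanSpace.real_norm_sq_eq]
    ring⟩

variable {n : ℕ}

theorem wrapBall_zero (z : closedBall (0 : EuclideanSpace ℝ (Fin n)) 1) :
    (wrapBall z).1 0 = 2 * ‖z.1‖ ^ 2 - 1 := rfl

theorem wrapBall_succ (z : closedBall (0 : EuclideanSpace ℝ (Fin n)) 1) (i : Fin n) :
    (wrapBall z).1 i.succ = 2 * √(1 - ‖z.1‖ ^ 2) * z.1 i := rfl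

theorem sphereBase_zero : (sphereBase n).1 0 = 1 := by
  simp only [sphereBase, PiLp.single_apply, if_true]

theorem sphereBase_succ (i : Fin n) : (sphereBase n).1 i.succ = 0 := by
  simp only [sphereBase, PiLp.single_apply, Fin.succ_ne_zero, if_false]

theorem unitSphere_ext {x y : unitSphere n} (h_zero : x.1 0 = y.1 0)
    (h_succ : ∀ i : Fin n, x.1 i.succ = y.1 i.succ) : x = y :=
  Subtype.ext (PiLp.ext (Fin.cases h_zero h_succ))

theorem sq_zero_add_sum_sq_succ (y : unitSphere n) :
    y.1 0 ^ 2 + ∑ i : Fin n, y.1 i.succ ^ 2 = 1 := by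
  rw [← Fin.sum_univ_succ (fun i => y.1 i ^ 2), ← EuclideanSpace.real_norm_sq_eq,
    mem_sphere_zero_iff_norm.1 y.2, one_pow]

theorem zero_lt_one_of_ne_sphereBase {y : unitSphere n} (hy : y ≠ sphereBase n) :
    y.1 0 < 1 := by
  by_contra! h
  have hsum := sq_zero_add_sum_sq_succ y
  have hnonneg : 0 ≤ ∑ i : Fin n, y.1 i.succ ^ 2 := Finset.sum_nonneg fun _ _ => sq_nonneg _
  have hzero : ∑ i : Fin n, y.1 i.succ ^ 2 = 0 := by nlinarith
  refine hy (unitSphere_ext ?_ fun i => ?_)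
  · rw [sphereBase_zero]
    nlinarith
  · rw [sphereBase_succ]
    exact pow_eq_zero_iff two_ne_zero |>.1
      ((Finset.sum_eq_zero_iff_of_nonneg fun _ _ => sq_nonneg _).1 hzero i (Finset.mem_univ i))

theorem continuous_wrapBall : Continuous (wrapBall (n := n)) := by
  refine Continuous.subtype_mk ((PiLp.continuous_toLp 2 _).comp ?_) _
  refine continuous_pi fun i => Fin.cases ?_ (fun j => ?_) i
  · simp only [Fin.cons_zero]
    fun_prop
  · simp only [Fin.cons_succ]
    fun_prop

theorem wrapBall_eq_sphereBase_iff (z : closedBall (0 : EuclideanSpace ℝ (Fin n)) 1) :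
    wrapBall z = sphereBase n ↔ ‖z.1‖ = 1 := by
  refine ⟨fun h => ?_, fun h => unitSphere_ext ?_ fun i => ?_⟩
  · have h_zero : 2 * ‖z.1‖ ^ 2 - 1 = 1 := by rw [← wrapBall_zero, h, sphereBase_zero]
    nlinarith [norm_nonneg z.1]
  · rw [wrapBall_zero, sphereBase_zero, h]
    norm_num
  · rw [wrapBall_succ, sphereBase_succ, h]
    simp

theorem injOn_wrapBall :
    {z : closedBall (0 : EuclideanSpace ℝ (Fin n)) 1 | ‖z.1‖ = 1}ᶜ.InjOn wrapBall := by
  intro z hz w _ h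
  have hnorm : ‖z.1‖ ^ 2 = ‖w.1‖ ^ 2 := by
    have h₀ : 2 * ‖z.1‖ ^ 2 - 1 = 2 * ‖w.1‖ ^ 2 - 1 := congr(($h).1 0)
    linarith
  have hz' : ‖z.1‖ < 1 := lt_of_le_of_ne (mem_closedBall_zero_iff.1 z.2) hz
  have hsqrt : √(1 - ‖z.1‖ ^ 2) ≠ 0 :=
    (Real.sqrt_pos.2 (by nlinarith [norm_nonneg z.1])).ne'
  ext i
  have hi : 2 * √(1 - ‖z.1‖ ^ 2) * z.1 i = 2 * √(1 - ‖w.1‖ ^ 2) * w.1 i := congr(($h).1 i.succ)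
  rw [← hnorm] at hi
  exact mul_left_cancel₀ (mul_ne_zero two_ne_zero hsqrt) hi

theorem surjective_wrapBall (hn : n ≠ 0) : (wrapBall (n := n)).Surjective := by
  intro y
  by_cases hbase : y = sphereBase n
  · refine ⟨⟨EuclideanSpace.single ⟨0, Nat.pos_of_ne_zero hn⟩ 1, by simp⟩, ?_⟩
    rw [hbase, wrapBall_eq_sphereBase_iff]
    simp
  have hy : 0 < 1 - y.1 0 := sub_pos.2 (zero_lt_one_of_ne_sphereBase hbase)
  let r : ℝ := 2 * √((1 - y.1 0) / 2)
  have hr : r ≠ 0 := mul_ne_zero two_ne_zero (Real.sqrt_pos.2 (by linarith)).ne'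
  have hr_sq : r ^ 2 = 2 * (1 - y.1 0) := by
    rw [mul_pow, Real.sq_sqrt (by linarith)]
    ring
  let z : EuclideanSpace ℝ (Fin n) := WithLp.toLp 2 fun i => y.1 i.succ / r
  have hz : ‖z‖ ^ 2 = (1 + y.1 0) / 2 := by
    simp only [z, EuclideanSpace.real_norm_sq_eq, div_pow, ← Finset.sum_div, hr_sq,
      eq_sub_of_add_eq' (sq_zero_add_sum_sq_succ y)]
    field_simp
    ring
  refine ⟨⟨z, mem_closedBall_zero_iff.2 (by nlinarith [norm_nonneg z])⟩,
    unitSphere_ext ?_ fun i => ?_⟩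
  · rw [wrapBall_zero, hz]
    ring
  · change 2 * √(1 - ‖z‖ ^ 2) * (y.1 i.succ / r) = y.1 i.succ
    rw [hz, show 1 - (1 + y.1 0) / 2 = (1 - y.1 0) / 2 by ring]
    exact mul_div_cancel₀ _ hr

theorem isCollapse_wrapBall (hn : n ≠ 0) :
    IsCollapse (wrapBall (n := n)) {z | ‖z.1‖ = 1} (sphereBase n) :=
  .of_continuous continuous_wrapBall (surjective_wrapBall hn) wrapBall_eq_sphereBase_iff
    injOn_wrapBall

theorem exists_homeomorph_closedBall {E : Type*} [NormedAddCommGroup E] [NormedSpace ℝ E]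
    {s : Set E} (hs : Convex ℝ s) (hclosed : IsClosed s) (hbdd : Bornology.IsBounded s)
    (hne : (interior s).Nonempty) :
    ∃ h : s ≃ₜ closedBall (0 : E) 1, ∀ x, ‖(h x).1‖ = 1 ↔ x.1 ∉ interior s := by
  obtain ⟨h, h_int, h_closure, -⟩ :=
    exists_homeomorph_image_interior_closure_frontier_eq_unitBall hs hne hbdd
  rw [hclosed.closure_eq] at h_closure
  refine ⟨(h.image s).trans (Homeomorph.setCongr h_closure), fun x => ?_⟩
  have hle : ‖h x‖ ≤ 1 := by
    rw [← mem_closedBall_zero_iff, ← h_closure]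
    exact Set.mem_image_of_mem h x.2
  change ‖h x‖ = 1 ↔ _
  rw [← h.injective.mem_set_image, h_int, mem_ball_zero_iff, not_lt, hle.ge_iff_eq]

/-- Barycentric coordinates, as a homeomorphism from the standard simplex to the simplex spanned
by an affine basis. -/
noncomputable def simplexHomeomorph {α E : Type*} [Fintype α] [NormedAddCommGroup E]
    [NormedSpace ℝ E] [FiniteDimensional ℝ E] (b : AffineBasis α ℝ E) :
    stdSimplex ℝ α ≃ₜ convexHull ℝ (Set.range b) where
  toFun y := ⟨∑ i, y.1 i • b i, by
    rw [convexHull_range_eq_exists_affineCombination]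
    exact ⟨Finset.univ, y.1, fun i _ => y.2.1 i, y.2.2,
      Finset.affineCombination_eq_linear_combination _ _ _ y.2.2⟩⟩
  invFun x := ⟨fun i => b.coord i x, by
    exact ⟨b.convexHull_eq_nonneg_coord.subset x.2, b.sum_coord_apply_eq_one x.1⟩⟩
  left_inv y := by
    ext i
    change b.coord i (∑ i, y.1 i • b i) = y.1 i
    rw [← Finset.affineCombination_eq_linear_combination _ _ _ y.2.2,
      b.coord_apply_combination_of_mem (Finset.mem_univ i) y.2.2]
  right_inv x := Subtype.ext (b.linear_combination_coord_eq_self x.1)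
  continuous_toFun := Continuous.subtype_mk (continuous_finsetSum _ fun i _ =>
    ((continuous_apply i).comp continuous_subtype_val).smul continuous_const) _
  continuous_invFun := Continuous.subtype_mk (continuous_pi fun i =>
    (continuous_barycentric_coord b i).comp continuous_subtype_val) _

theorem exists_isCollapse_stdSimplex {α : Type*} [Fintype α] (hα : Fintype.card α = n + 1)
    (hn : n ≠ 0) : ∃ σ : stdSimplex ℝ α → unitSphere n,
      IsCollapse σ {y | ∃ i, y i = 0} (sphereBase n) := by
  obtain ⟨b⟩ : Nonempty (AffineBasis α ℝ (EuclideanSpace ℝ (Fin n))) := by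
    refine AffineBasis.exists_affineBasis_of_finiteDimensional ?_
    rw [hα, finrank_euclideanSpace_fin]
  have hfinite := Set.finite_range b
  obtain ⟨h, hh⟩ := exists_homeomorph_closedBall (convex_convexHull ℝ (Set.range b))
    (hfinite.isClosed_convexHull ℝ) (hfinite.isCompact_convexHull ℝ).isBounded
    ⟨_, b.centroid_mem_interior_convexHull⟩
  let e : stdSimplex ℝ α ≃ₜ closedBall (0 : EuclideanSpace ℝ (Fin n)) 1 :=
    (simplexHomeomorph b).trans h
  refine ⟨wrapBall ∘ e, ?_⟩
  convert (isCollapse_wrapBall hn).comp_homeomorph e using 1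
  ext y
  have hcoord (i : α) : b.coord i (simplexHomeomorph b y) = y.1 i :=
    congr(($((simplexHomeomorph b).symm_apply_apply y)).1 i)
  change _ ↔ ‖(h (simplexHomeomorph b y)).1‖ = 1
  rw [hh, b.interior_convexHull]
  simp only [Set.mem_ofPred_eq, hcoord, not_forall, not_lt]
  exact exists_congr fun i => ⟨fun hi => hi.le, fun hi => hi.antisymm (y.2.1 i)⟩

end Balls

/-! ### Geometric realizations of simplicial complexes -/

section Realization

variable {ι : Type*} [Fintype ι]

/-- The set of vertices at which a point, given by its barycentric coordinates, has a nonzero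
coordinate: the vertices of the smallest face which contains the point. -/
noncomputable def vertexSupport (x : ι → ℝ) : Finset ι := {i | x i ≠ 0}

theorem mem_vertexSupport {x : ι → ℝ} {i : ι} : i ∈ vertexSupport x ↔ x i ≠ 0 := by
  simp only [vertexSupport, Finset.mem_filter_univ]

theorem notMem_vertexSupport {x : ι → ℝ} {i : ι} : i ∉ vertexSupport x ↔ x i = 0 := by
  rw [mem_vertexSupport, not_not]

theorem vertexSupport_subset_iff {x : ι → ℝ} {F : Finset ι} :
    vertexSupport x ⊆ F ↔ ∀ i ∉ F, x i = 0 := by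
  simp only [Finset.subset_iff, mem_vertexSupport, not_imp_comm]

/-- The geometric realization of a finite simplicial complex, in barycentric coordinates. A
complex with vertices in `ι` is encoded as the lower set of its faces in `Finset ι`; whether the
empty face belongs to it is irrelevant. -/
def realization (K : LowerSet (Finset ι)) : Set (ι → ℝ) :=
  {x | x ∈ stdSimplex ℝ ι ∧ vertexSupport x ∈ K}

theorem realization_mono {K L : LowerSet (Finset ι)} (h : L ≤ K) :
    realization L ⊆ realization K :=
  fun _ hx => ⟨hx.1, h hx.2⟩

theorem isCompact_realization (K : LowerSet (Finset ι)) : IsCompact (realization K) := by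
  have h_eq : realization K =
      ⋃ F ∈ (K : Set (Finset ι)), stdSimplex ℝ ι ∩ ⋂ i ∉ F, {x | x i = 0} := by
    ext x
    simp only [Set.mem_iUnion, Set.mem_inter_iff, Set.mem_iInter, exists_prop]
    exact ⟨fun hx => ⟨_, hx.2, hx.1, vertexSupport_subset_iff.1 subset_rfl⟩,
      fun ⟨F, hF, hx, hxF⟩ => ⟨hx, K.lower (vertexSupport_subset_iff.2 hxF) hF⟩⟩
  rw [h_eq]
  exact (Set.toFinite _).isCompact_biUnion fun F _ => (isCompact_stdSimplex ℝ ι).inter_right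
    (isClosed_biInter fun i _ => isClosed_eq (continuous_apply i) continuous_const)

end Realization

/-! ### The collar of a subcomplex -/

section SubcomplexCollar

variable {ι : Type*} [Fintype ι]

/-- Lower all the barycentric coordinates by `s`, cut them off at `0`, and normalize. For small `s`
this deforms the realization of a complex and moves the points close to a subcomplex into it. -/
noncomputable def shrink (s : ℝ) (x : ι → ℝ) : ι → ℝ :=
  (∑ i, max (x i - s) 0)⁻¹ • fun i => max (x i - s) 0

theorem sum_max_sub_pos {x : ι → ℝ} (hx : x ∈ stdSimplex ℝ ι) {s : ℝ}
    (hs : Fintype.card ι * s < 1) : 0 < ∑ i, max (x i - s) 0 :=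
  calc 0 < 1 - Fintype.card ι * s := sub_pos.2 hs
    _ = ∑ i, (x i - s) := by
      rw [Finset.sum_sub_distrib, hx.2, Finset.sum_const, Finset.card_univ, nsmul_eq_mul]
    _ ≤ ∑ i, max (x i - s) 0 := Finset.sum_le_sum fun _ _ => le_max_left _ _

theorem shrink_mem_stdSimplex {x : ι → ℝ} (hx : x ∈ stdSimplex ℝ ι) {s : ℝ}
    (hs : Fintype.card ι * s < 1) : shrink s x ∈ stdSimplex ℝ ι := by
  have hpos := sum_max_sub_pos hx hs
  refine ⟨fun _ => mul_nonneg (inv_nonneg.2 hpos.le) (le_max_right _ _), ?_⟩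
  simp only [shrink, Pi.smul_apply, smul_eq_mul, ← Finset.mul_sum]
  exact inv_mul_cancel₀ hpos.ne'

theorem shrink_zero {x : ι → ℝ} (hx : x ∈ stdSimplex ℝ ι) : shrink 0 x = x := by
  simp only [shrink, sub_zero, max_eq_left (hx.1 _), hx.2, inv_one, one_smul]

theorem shrink_apply_eq_zero {x : ι → ℝ} {s : ℝ} {i : ι} (h : x i ≤ s) : shrink s x i = 0 := by
  simp only [shrink, Pi.smul_apply, max_eq_right (sub_nonpos.2 h), smul_zero]

theorem vertexSupport_shrink_subset {s : ℝ} (hs : 0 ≤ s) (x : ι → ℝ) :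
    vertexSupport (shrink s x) ⊆ vertexSupport x :=
  vertexSupport_subset_iff.2 fun _ hi =>
    shrink_apply_eq_zero ((notMem_vertexSupport.1 hi).trans_le hs)

theorem shrink_mem_realization {K : LowerSet (Finset ι)} {x : ι → ℝ} (hx : x ∈ realization K)
    {s : ℝ} (hs₀ : 0 ≤ s) (hs : Fintype.card ι * s < 1) : shrink s x ∈ realization K :=
  ⟨shrink_mem_stdSimplex hx.1 hs, K.lower (vertexSupport_shrink_subset hs₀ x) hx.2⟩

theorem shrink_mem_realization_of_infDist_le {L : LowerSet (Finset ι)}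
    (hL : (realization L).Nonempty) {x : ι → ℝ} (hx : x ∈ stdSimplex ℝ ι) {s : ℝ}
    (hs : Fintype.card ι * s < 1) (hxs : infDist x (realization L) ≤ s) :
    shrink s x ∈ realization L := by
  obtain ⟨y, hy, hxy⟩ := (isCompact_realization L).exists_infDist_eq_dist hL x
  refine ⟨shrink_mem_stdSimplex hx hs, L.lower (vertexSupport_subset_iff.2 fun i hi => ?_) hy.2⟩
  refine shrink_apply_eq_zero ?_
  calc x i = x i - y i := by rw [notMem_vertexSupport.1 hi, sub_zero]
    _ ≤ dist (x i) (y i) := le_abs_self _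
    _ ≤ dist x y := dist_le_pi_dist x y i
    _ ≤ s := hxy ▸ hxs

/-- A subcomplex has a collar: move by `shrink`, with a speed for which the coordinates of a point
of the simplex cannot all become `0` by time `1`. -/
noncomputable def subcomplexCollar (K : LowerSet (Finset ι)) {L : LowerSet (Finset ι)}
    (hL : (realization L).Nonempty) :
    Collar ((↑) ⁻¹' realization L : Set (realization K)) :=
  have hspeed (t : unitInterval) : Fintype.card ι * (t / (Fintype.card ι + 1) : ℝ) < 1 := by
    rw [mul_div_assoc', div_lt_one (by positivity)]
    nlinarith [t.2.2, (Fintype.card ι).cast_nonneg (α := ℝ)]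
  have hnonneg (t : unitInterval) : 0 ≤ (t / (Fintype.card ι + 1) : ℝ) :=
    div_nonneg t.2.1 (by positivity)
  { deformation := fun p => ⟨shrink (p.1 / (Fintype.card ι + 1)) p.2.1,
      shrink_mem_realization p.2.2 (hnonneg p.1) (hspeed p.1)⟩
    depth := fun x => infDist x.1 (realization L) * (Fintype.card ι + 1)
    continuous_deformation := by
      have hcoord (i : ι) : Continuous fun p : unitInterval × realization K =>
          max (p.2.1 i - p.1 / (Fintype.card ι + 1)) 0 :=
        (((continuous_apply i).comp (continuous_subtype_val.comp continuous_snd)).sub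
          (by fun_prop)).max continuous_const
      refine Continuous.subtype_mk (Continuous.smul
        ((continuous_finsetSum _ fun i _ => hcoord i).inv₀ fun p => ?_)
        (continuous_pi hcoord)) _
      exact (sum_max_sub_pos p.2.2.1 (hspeed p.1)).ne'
    continuous_depth := by fun_prop
    deformation_zero := fun x => Subtype.ext (by simpa using shrink_zero x.2.1)
    depth_nonneg := fun x => mul_nonneg infDist_nonneg (by positivity)
    depth_eq_zero := fun x hx => by rw [infDist_zero_of_mem (s := realization L) hx, zero_mul]
    deformation_mem := fun t x htx => shrink_mem_realization_of_infDist_le hL x.2.1 (hspeed t)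
      ((le_div_iff₀ (by positivity)).2 htx) }

end SubcomplexCollar

/-! ### Removing facets -/

section Facets

variable {ι : Type*}

/-- The inclusion of the face with vertex set `F` into the simplex on all vertices. -/
noncomputable def faceInclusion (F : Finset ι) (y : stdSimplex ℝ F) : ι → ℝ :=
  Function.extend (↑) y.1 (0 : ι → ℝ)

theorem faceInclusion_apply {F : Finset ι} (y : stdSimplex ℝ F) (i : F) :
    faceInclusion F y i = y.1 i :=
  Subtype.val_injective.extend_apply y.1 (0 : ι → ℝ) i

theorem faceInclusion_apply_of_notMem {F : Finset ι} (y : stdSimplex ℝ F) {i : ι} (hi : i ∉ F) :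
    faceInclusion F y i = 0 :=
  Function.extend_apply' y.1 (0 : ι → ℝ) i fun ⟨j, hj⟩ => hi (hj ▸ j.2)

theorem faceInclusion_injective (F : Finset ι) : (faceInclusion F).Injective := fun y z h =>
  Subtype.ext (funext fun i => by rw [← faceInclusion_apply, h, faceInclusion_apply])

theorem continuous_faceInclusion (F : Finset ι) : Continuous (faceInclusion F) := by
  refine continuous_pi fun i => ?_
  by_cases hi : i ∈ F
  · simp only [faceInclusion_apply _ ⟨i, hi⟩]
    exact (continuous_apply _).comp continuous_subtype_val
  · simp only [faceInclusion_apply_of_notMem _ hi]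
    exact continuous_const

variable [Fintype ι]

theorem vertexSupport_faceInclusion_subset (F : Finset ι) (y : stdSimplex ℝ F) :
    vertexSupport (faceInclusion F y) ⊆ F :=
  vertexSupport_subset_iff.2 fun _ hi => faceInclusion_apply_of_notMem y hi

theorem subset_vertexSupport_faceInclusion_iff (F : Finset ι) (y : stdSimplex ℝ F) :
    F ⊆ vertexSupport (faceInclusion F y) ↔ ∀ i, y.1 i ≠ 0 := by
  refine ⟨fun h i => ?_, fun h i hi => ?_⟩
  · rw [← faceInclusion_apply]
    exact mem_vertexSupport.1 (h i.2)
  · rw [mem_vertexSupport, faceInclusion_apply y ⟨i, hi⟩]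
    exact h _

theorem sum_faceInclusion {F : Finset ι} (y : stdSimplex ℝ F) : ∑ i, faceInclusion F y i = 1 := by
  rw [← Finset.sum_subset F.subset_univ fun i _ hi => faceInclusion_apply_of_notMem y hi,
    ← Finset.sum_coe_sort]
  simp only [faceInclusion_apply, y.2.2]

theorem faceInclusion_mem_stdSimplex {F : Finset ι} (y : stdSimplex ℝ F) :
    faceInclusion F y ∈ stdSimplex ℝ ι := by
  refine ⟨fun i => ?_, sum_faceInclusion y⟩
  by_cases hi : i ∈ F
  · exact (y.2.1 ⟨i, hi⟩).trans_eq (faceInclusion_apply y ⟨i, hi⟩).symm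
  · exact (faceInclusion_apply_of_notMem y hi).ge

theorem exists_faceInclusion_eq {F : Finset ι} {x : ι → ℝ} (hx : x ∈ stdSimplex ℝ ι)
    (hF : vertexSupport x ⊆ F) : ∃ y, faceInclusion F y = x := by
  have hzero := vertexSupport_subset_iff.1 hF
  refine ⟨⟨fun i => x i, fun i => hx.1 i, ?_⟩, funext fun i => ?_⟩
  · rw [Finset.sum_coe_sort F x, Finset.sum_subset F.subset_univ fun i _ hi => hzero i hi, hx.2]
  · by_cases hi : i ∈ F
    · exact faceInclusion_apply _ ⟨i, hi⟩
    · rw [faceInclusion_apply_of_notMem _ hi, hzero i hi]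

variable {K : LowerSet (Finset ι)} {κ : Type*} {T : κ → Finset ι}

/-- The inclusion of the face `T a` of a complex `K` into the realization of `K`. -/
noncomputable def faceCell (hT : ∀ a, T a ∈ K) (a : κ) (y : stdSimplex ℝ (T a)) : realization K :=
  ⟨faceInclusion (T a) y, faceInclusion_mem_stdSimplex y,
    K.lower (vertexSupport_faceInclusion_subset _ y) (hT a)⟩

theorem mem_realization_sdiff_range {x : ι → ℝ} (hx : x ∈ realization K) :
    x ∈ realization (K.sdiff (Set.range T)) ↔ ∀ a, ¬ T a ⊆ vertexSupport x := by
  change x ∈ stdSimplex ℝ ι ∧ vertexSupport x ∈ K ∧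
    vertexSupport x ∉ upperClosure (Set.range T) ↔ _
  rw [mem_upperClosure, Set.exists_range_iff, not_exists]
  exact ⟨fun h => h.2.2, fun h => ⟨hx.1, hx.2, h⟩⟩

theorem faceCell_mem_realization_sdiff_range (hinj : T.Injective)
    (hT : ∀ a, Maximal (· ∈ K) (T a)) (a : κ) (y : stdSimplex ℝ (T a)) :
    (faceCell (fun a => (hT a).prop) a y).1 ∈ realization (K.sdiff (Set.range T)) ↔
      ∃ i, y.1 i = 0 := by
  rw [mem_realization_sdiff_range (Subtype.coe_prop _), ← not_iff_not]
  push Not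
  rw [← subset_vertexSupport_faceInclusion_iff]
  refine ⟨fun ⟨b, hb⟩ => ?_, fun h => ⟨a, h⟩⟩
  have hba : T b ⊆ T a := hb.trans (vertexSupport_faceInclusion_subset _ y)
  rwa [hinj ((hT b).eq_of_le (hT a).prop hba)] at hb

theorem isCellFamily_faceCell (hinj : T.Injective) (hT : ∀ a, Maximal (· ∈ K) (T a)) :
    IsCellFamily (faceCell fun a => (hT a).prop)
      ((↑) ⁻¹' realization (K.sdiff (Set.range T))) where
  isClosed := (isCompact_realization _).isClosed.preimage continuous_subtype_val
  continuous a := (continuous_faceInclusion (T a)).subtype_mk _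
  cover x hx := by
    rw [Set.mem_preimage, mem_realization_sdiff_range x.2] at hx
    push Not at hx
    obtain ⟨a, ha⟩ := hx
    obtain ⟨y, hy⟩ := exists_faceInclusion_eq x.2.1 ((hT a).le_of_ge x.2.2 ha)
    exact ⟨a, y, Subtype.ext hy⟩
  inj a b y z h hy := by
    have h' : faceInclusion (T a) y = faceInclusion (T b) z := congrArg Subtype.val h
    rw [Set.mem_preimage, faceCell_mem_realization_sdiff_range hinj hT, not_exists,
      ← subset_vertexSupport_faceInclusion_iff, h'] at hy
    obtain rfl := hinj ((hT a).eq_of_le (hT b).prop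
      (hy.trans (vertexSupport_faceInclusion_subset _ z)))
    rw [faceInclusion_injective _ h']

theorem nonempty_homotopyEquiv_wedge [Finite κ] [Nonempty κ] (hinj : T.Injective)
    (hT : ∀ a, Maximal (· ∈ K) (T a)) {n : κ → ℕ} (hcard : ∀ a, (T a).card = n a + 1)
    (hn : ∀ a, n a ≠ 0) [ContractibleSpace (realization (K.sdiff (Set.range T)))] :
    Nonempty (ContinuousMap.HomotopyEquiv (realization K)
      (Wedge (fun a => unitSphere (n a)) fun a => sphereBase (n a))) := by
  have : ContractibleSpace ((↑) ⁻¹' realization (K.sdiff (Set.range T)) : Set (realization K)) :=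
    (Topology.IsEmbedding.subtypeVal.homeomorphOfSubsetRange (Subtype.range_coe.symm ▸
      realization_mono LowerSet.sdiff_le_left)).contractibleSpace
  choose σ hσ using fun a =>
    exists_isCollapse_stdSimplex ((Fintype.card_coe (T a)).trans (hcard a)) (hn a)
  have hσ' (a : κ) : IsCollapse (σ a) (faceCell (fun a => (hT a).prop) a ⁻¹'
      ((↑) ⁻¹' realization (K.sdiff (Set.range T)))) (sphereBase (n a)) := by
    convert hσ a using 1
    ext y
    exact faceCell_mem_realization_sdiff_range hinj hT a y
  obtain ⟨f, w₀, hf⟩ := (isCellFamily_faceCell hinj hT).exists_isCollapse_wedge hσ'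
  exact hf.nonempty_homotopyEquiv (subcomplexCollar K (Set.nonempty_coe_sort.1 inferInstance))

end Facets

/-! ### Cones and elementary collapses -/

section Contractibility

theorem contractibleSpace_of_homotopic_id {X Y : Type*} [TopologicalSpace X] [TopologicalSpace Y]
    [ContractibleSpace Y] {r : C(X, Y)} {j : C(Y, X)}
    (h : (ContinuousMap.id X).Homotopic (j.comp r)) : ContractibleSpace X := by
  obtain ⟨x, hx⟩ := ((id_nullhomotopic Y).comp_left r).comp_right j
  exact (contractible_iff_id_nullhomotopic X).2 ⟨x, h.trans hx⟩

variable {ι : Type*} [Fintype ι] {K : LowerSet (Finset ι)}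

theorem lineMap_mem_realization {F : Finset ι} (hF : F ∈ K) {x y : ι → ℝ}
    (hx : x ∈ stdSimplex ℝ ι) (hy : y ∈ stdSimplex ℝ ι) (hxF : vertexSupport x ⊆ F)
    (hyF : vertexSupport y ⊆ F) (t : unitInterval) :
    AffineMap.lineMap x y (t : ℝ) ∈ realization K := by
  refine ⟨(convex_stdSimplex ℝ ι).lineMap_mem hx hy t.2, K.lower ?_ hF⟩
  rw [vertexSupport_subset_iff] at hxF hyF ⊢
  intro i hi
  rw [AffineMap.lineMap_apply_module]
  simp only [Pi.add_apply, Pi.smul_apply, hxF i hi, hyF i hi, smul_zero, add_zero]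

theorem contractibleSpace_realization_of_contiguous {A : Set (ι → ℝ)} [ContractibleSpace A]
    (hA : A ⊆ realization K) {g : (ι → ℝ) → ι → ℝ} (hg : Continuous g)
    (hgA : ∀ x ∈ realization K, g x ∈ A)
    (hgK : ∀ x ∈ realization K, ∃ F ∈ K, vertexSupport x ⊆ F ∧ vertexSupport (g x) ⊆ F) :
    ContractibleSpace (realization K) := by
  have hline (t : unitInterval) (x : realization K) :
      AffineMap.lineMap x.1 (g x) (t : ℝ) ∈ realization K := by
    obtain ⟨F, hF, hxF, hgF⟩ := hgK x x.2
    exact lineMap_mem_realization hF x.2.1 (hA (hgA x x.2)).1 hxF hgF t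
  refine contractibleSpace_of_homotopic_id
    (r := ⟨fun x => ⟨g x, hgA x x.2⟩, (hg.comp continuous_subtype_val).subtype_mk _⟩)
    (j := ⟨Set.inclusion hA, continuous_inclusion hA⟩) ⟨{
      toFun := fun q => ⟨AffineMap.lineMap q.2.1 (g q.2) (q.1 : ℝ), hline q.1 q.2⟩
      continuous_toFun := ?_
      map_zero_left := fun x => Subtype.ext (AffineMap.lineMap_apply_zero _ _)
      map_one_left := fun x => Subtype.ext (AffineMap.lineMap_apply_one _ _) }⟩
  simp only [AffineMap.lineMap_apply_module]
  fun_prop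

theorem contractibleSpace_realization_of_cone [DecidableEq ι] (hK : (K : Set (Finset ι)).Nonempty)
    {v : ι} (hv : ∀ F ∈ K, insert v F ∈ K) : ContractibleSpace (realization K) := by
  have hsupp : vertexSupport (Pi.single v (1 : ℝ)) ⊆ {v} :=
    vertexSupport_subset_iff.2 fun i hi => Pi.single_eq_of_ne (Finset.notMem_singleton.1 hi) _
  have hsingle (F : Finset ι) : ({v} : Finset ι) ⊆ insert v F :=
    Finset.singleton_subset_iff.2 (Finset.mem_insert_self v F)
  obtain ⟨F, hF⟩ := hK
  have hapex : Pi.single v 1 ∈ realization K :=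
    ⟨single_mem_stdSimplex ℝ v, K.lower (hsupp.trans (hsingle F)) (hv F hF)⟩
  exact contractibleSpace_realization_of_contiguous (Set.singleton_subset_iff.2 hapex)
    continuous_const (fun _ _ => Set.mem_singleton _) fun x hx =>
      ⟨_, hv _ hx.2, Finset.subset_insert _ _, hsupp.trans (hsingle _)⟩

end Contractibility

section ElementaryCollapse

variable {ι : Type*} [DecidableEq ι] {T : Finset ι} (hT : T.Nonempty) {v : ι}

/-- Move the weight which all the vertices in `T` have in common to the vertex `v`. -/
noncomputable def pushWeight (v : ι) (x : ι → ℝ) : ι → ℝ :=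
  x + T.inf' hT x • (Pi.single v (T.card : ℝ) - (T : Set ι).indicator 1)

theorem continuous_pushWeight : Continuous (pushWeight hT v) :=
  continuous_id.add ((Continuous.finset_inf'_apply hT fun i _ => continuous_apply i).smul
    continuous_const)

theorem pushWeight_self (hv : v ∉ T) (x : ι → ℝ) :
    pushWeight hT v x v = x v + T.inf' hT x * T.card := by
  simp [pushWeight, hv]

theorem pushWeight_of_mem (hv : v ∉ T) (x : ι → ℝ) {i : ι} (hi : i ∈ T) :
    pushWeight hT v x i = x i - T.inf' hT x := by
  simp [pushWeight, hi, ne_of_mem_of_not_mem hi hv, sub_eq_add_neg]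

theorem pushWeight_of_notMem (x : ι → ℝ) {i : ι} (hi : i ∉ insert v T) :
    pushWeight hT v x i = x i := by
  rw [Finset.mem_insert, not_or] at hi
  simp [pushWeight, hi.1, hi.2]

theorem exists_mem_pushWeight_eq_zero (hv : v ∉ T) (x : ι → ℝ) :
    ∃ i ∈ T, pushWeight hT v x i = 0 := by
  obtain ⟨i, hi, hmin⟩ := T.exists_mem_eq_inf' hT x
  exact ⟨i, hi, by rw [pushWeight_of_mem hT hv x hi, hmin, sub_self]⟩

variable [Fintype ι] {K : LowerSet (Finset ι)}

theorem pushWeight_mem_stdSimplex (hv : v ∉ T) {x : ι → ℝ} (hx : x ∈ stdSimplex ℝ ι) :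
    pushWeight hT v x ∈ stdSimplex ℝ ι := by
  refine ⟨fun i => ?_, ?_⟩
  · by_cases hi : i ∈ insert v T
    · rcases Finset.mem_insert.1 hi with rfl | hi
      · rw [pushWeight_self hT hv]
        exact add_nonneg (hx.1 i)
          (mul_nonneg ((Finset.le_inf'_iff hT x).2 fun j _ => hx.1 j) T.card.cast_nonneg)
      · rw [pushWeight_of_mem hT hv x hi]
        exact sub_nonneg.2 (Finset.inf'_le x hi)
    · exact (hx.1 i).trans_eq (pushWeight_of_notMem hT x hi).symm
  · simp [pushWeight, Finset.sum_add_distrib, ← Finset.mul_sum, hx.2, Set.indicator_apply]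

theorem vertexSupport_pushWeight_subset_insert (x : ι → ℝ) :
    vertexSupport (pushWeight hT v x) ⊆ vertexSupport x ∪ insert v T := by
  rw [vertexSupport_subset_iff]
  intro i hi
  rw [Finset.notMem_union, notMem_vertexSupport] at hi
  rw [pushWeight_of_notMem hT x hi.2, hi.1]

theorem pushWeight_eq_self {x : ι → ℝ} (hx : ∀ i, 0 ≤ x i) (h : ¬ T ⊆ vertexSupport x) :
    pushWeight hT v x = x := by
  obtain ⟨i, hi, hxi⟩ := Finset.not_subset.1 h
  have hmin : T.inf' hT x = 0 :=
    ((Finset.inf'_le x hi).trans_eq (notMem_vertexSupport.1 hxi)).antisymm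
      ((Finset.le_inf'_iff hT x).2 fun j _ => hx j)
  rw [pushWeight, hmin, zero_smul, add_zero]

/-- The faces which contain `T` come in pairs `F`, `insert v F`. -/
theorem contractibleSpace_realization_of_erase (hT : T.Nonempty) (hv : v ∉ T)
    (hK : ∀ F ∈ K, T ⊆ F → insert v F ∈ K)
    (hcontractible : ContractibleSpace (realization (K.erase T))) :
    ContractibleSpace (realization K) := by
  have hcarrier (x : ι → ℝ) (hx : x ∈ realization K) :
      ∃ F ∈ K, vertexSupport x ⊆ F ∧ vertexSupport (pushWeight hT v x) ⊆ F := by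
    by_cases hTx : T ⊆ vertexSupport x
    · refine ⟨_, hK _ hx.2 hTx, Finset.subset_insert _ _, ?_⟩
      convert vertexSupport_pushWeight_subset_insert hT x using 1
      rw [Finset.union_insert, Finset.union_eq_left.2 hTx]
    · exact ⟨_, hx.2, subset_rfl, by rw [pushWeight_eq_self hT hx.1.1 hTx]⟩
  refine contractibleSpace_realization_of_contiguous (realization_mono (K.erase_le (a := T)))
    (continuous_pushWeight hT) (fun x hx => ⟨pushWeight_mem_stdSimplex hT hv hx.1, ?_⟩) hcarrier
  obtain ⟨F, hF, -, hpush⟩ := hcarrier x hx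
  refine ⟨K.lower hpush hF, fun h => ?_⟩
  obtain ⟨i, hi, hzero⟩ := exists_mem_pushWeight_eq_zero hT hv x
  exact notMem_vertexSupport.2 hzero (h hi)

end ElementaryCollapse

/-! ### Barycentric subdivision -/

section Subdivision

variable {ι P : Type*} {e : P → Finset ι}

/-- The last member of the chain not to contain `F` omits an element of `F`. -/
theorem exists_mem_forall_subset [Finite P] [PartialOrder P] (he : Antitone e) {S : Set P}
    (hS : IsChain (· ≤ ·) S) {F : Finset ι} (hF : F.Nonempty) :
    ∃ i ∈ F, ∀ q ∈ S, i ∈ e q → F ⊆ e q := by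
  rcases Set.eq_empty_or_nonempty {q ∈ S | ¬ F ⊆ e q} with hempty | hnonempty
  · obtain ⟨i, hi⟩ := hF
    refine ⟨i, hi, fun q hq _ => ?_⟩
    by_contra h
    exact Set.eq_empty_iff_forall_notMem.1 hempty q ⟨hq, h⟩
  · obtain ⟨q₀, hq₀⟩ := (Set.toFinite {q ∈ S | ¬ F ⊆ e q}).exists_minimal hnonempty
    obtain ⟨i, hi, hiq₀⟩ := Finset.not_subset.1 hq₀.prop.2
    refine ⟨i, hi, fun q hq hiq => ?_⟩
    by_contra h
    have hle : q₀ ≤ q := (hS.total hq₀.prop.1 hq).elim id (hq₀.le_of_le ⟨hq, h⟩)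
    exact hiq₀ (he hle hiq)

variable [Fintype P]

/-- The linear combinations of the indicator functions of a finite family of finite sets. -/
noncomputable def indicatorCombination (e : P → Finset ι) : (P → ℝ) →ₗ[ℝ] ι → ℝ :=
  Fintype.linearCombination ℝ fun p => (e p : Set ι).indicator 1

theorem indicatorCombination_single [DecidableEq P] (p : P) (r : ℝ) :
    indicatorCombination e (Pi.single p r) = r • (e p : Set ι).indicator 1 :=
  Fintype.linearCombination_apply_single _ _ _ _

theorem indicatorCombination_apply [DecidableEq ι] (c : P → ℝ) (i : ι) :
    indicatorCombination e c i = ∑ p with i ∈ e p, c p := by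
  simp only [indicatorCombination, Fintype.linearCombination_apply, Finset.sum_apply,
    Pi.smul_apply, Set.indicator_apply, Finset.mem_coe, Pi.one_apply, smul_eq_mul, mul_ite,
    mul_one, mul_zero, Finset.sum_filter]

theorem sum_indicatorCombination [Fintype ι] (c : P → ℝ) :
    ∑ i, indicatorCombination e c i = ∑ p, c p * (e p).card := by
  classical
  simp only [indicatorCombination_apply, Finset.sum_filter]
  rw [Finset.sum_comm]
  simp only [Finset.sum_ite_mem, Finset.univ_inter, Finset.sum_const, nsmul_eq_mul, mul_comm]

variable [PartialOrder P]

theorem inf'_indicatorCombination [DecidableEq ι] (he : Antitone e) {c : P → ℝ} (hc : 0 ≤ c)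
    (hchain : IsChain (· ≤ ·) (Function.support c)) {F : Finset ι} (hF : F.Nonempty) :
    F.inf' hF (indicatorCombination e c) = ∑ q with F ⊆ e q, c q := by
  refine le_antisymm ?_ ((Finset.le_inf'_iff hF _).2 fun i hi => ?_)
  · obtain ⟨i, hi, h⟩ := exists_mem_forall_subset he hchain hF
    refine (Finset.inf'_le _ hi).trans_eq ?_
    rw [indicatorCombination_apply]
    refine (Finset.sum_subset (Finset.monotone_filter_right _ fun q _ hq => hq hi)
      fun q hq hq' => ?_).symm
    simp only [Finset.mem_filter_univ] at hq hq'
    exact Function.notMem_support.1 fun hcq => hq' (h q hcq hq)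
  · rw [indicatorCombination_apply]
    exact Finset.sum_le_sum_of_subset_of_nonneg
      (Finset.monotone_filter_right _ fun q _ hq => hq hi) fun q _ _ => hc q

theorem eq_of_sum_le_eq [DecidableLE P] {M : Type*} [AddCommGroup M] {c d : P → M}
    (h : ∀ p, ∑ q with q ≤ p, c q = ∑ q with q ≤ p, d q) : c = d := by
  classical
  funext p
  induction p using WellFoundedLT.induction with
  | ind p ih =>
    have hsplit (f : P → M) : ∑ q with q ≤ p, f q = f p + ∑ q with q < p, f q := by
      rw [← Finset.sum_insert (by simp)]
      congr 1
      ext q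
      simp [le_iff_eq_or_lt]
    have hlt : ∑ q with q < p, c q = ∑ q with q < p, d q :=
      Finset.sum_congr rfl fun q hq => ih q (Finset.mem_filter.1 hq).2
    have hp := h p
    rwa [hsplit, hsplit, hlt, add_left_inj] at hp

theorem indicatorCombination_injOn (he : ∀ p q, p ≤ q ↔ e q ⊆ e p) (hne : ∀ p, (e p).Nonempty) :
    {c : P → ℝ | 0 ≤ c ∧ IsChain (· ≤ ·) (Function.support c)}.InjOn
      (indicatorCombination e) := by
  classical
  intro c hc d hd hcd
  have hanti : Antitone e := fun p q => (he p q).1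
  refine eq_of_sum_le_eq fun p => ?_
  simp only [he _ p]
  rw [← inf'_indicatorCombination hanti hc.1 hc.2 (hne p), hcd,
    inf'_indicatorCombination hanti hd.1 hd.2]

variable [Fintype ι] {K : LowerSet (Finset ι)}

theorem exists_sub_smul_indicator {x : ι → ℝ} (hx : 0 ≤ x) (hne : (vertexSupport x).Nonempty) :
    ∃ m : ℝ, 0 ≤ m ∧ 0 ≤ x - m • (vertexSupport x : Set ι).indicator 1 ∧
      vertexSupport (x - m • (vertexSupport x : Set ι).indicator 1) ⊂ vertexSupport x := by
  set m := (vertexSupport x).inf' hne x with hm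
  set y := x - m • (vertexSupport x : Set ι).indicator 1 with hy
  have hy_mem {i : ι} (hi : i ∈ vertexSupport x) : y i = x i - m := by simp [hy, hi]
  have hy_notMem {i : ι} (hi : i ∉ vertexSupport x) : y i = 0 := by
    simp [hy, hi, notMem_vertexSupport.1 hi]
  refine ⟨m, (Finset.le_inf'_iff hne x).2 fun i _ => hx i, fun i => ?_, ?_⟩
  · by_cases hi : i ∈ vertexSupport x
    · exact (sub_nonneg.2 (Finset.inf'_le x hi)).trans_eq (hy_mem hi).symm
    · exact (hy_notMem hi).ge
  · obtain ⟨i, hi, hmin⟩ := (vertexSupport x).exists_mem_eq_inf' hne x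
    refine Finset.ssubset_iff_subset_ne.2 ⟨vertexSupport_subset_iff.2 fun i => hy_notMem,
      fun h => mem_vertexSupport.1 (h ▸ hi) ?_⟩
    exact (hy_mem hi).trans (by rw [hm, hmin, sub_self])

theorem exists_indicatorCombination_eq (he : ∀ p q, e q ⊆ e p → p ≤ q)
    (hK : ∀ F ∈ K, F.Nonempty → F ∈ Set.range e) {x : ι → ℝ} (hx : 0 ≤ x)
    (hxK : vertexSupport x ∈ K) :
    ∃ c : P → ℝ, 0 ≤ c ∧ IsChain (· ≤ ·) (Function.support c) ∧
      (∀ p ∈ Function.support c, e p ⊆ vertexSupport x) ∧ indicatorCombination e c = x := by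
  classical
  induction hF : vertexSupport x using Finset.strongInduction generalizing x with
  | H F ih =>
  subst hF
  rcases (vertexSupport x).eq_empty_or_nonempty with hempty | hne
  · have hx0 : x = 0 := funext fun i => notMem_vertexSupport.1 (hempty ▸ Finset.notMem_empty i)
    exact ⟨0, le_rfl, by simp, by simp, by rw [map_zero, hx0]⟩
  obtain ⟨p₀, hp₀⟩ := hK _ hxK hne
  obtain ⟨m, hm, hy, hyx⟩ := exists_sub_smul_indicator hx hne
  obtain ⟨c, hc, hchain, hce, hcy⟩ := ih _ hyx hy (K.lower hyx.1 hxK) rfl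
  have hce' (p : P) (hp : p ∈ Function.support c) : e p ⊆ e p₀ := hp₀ ▸ (hce p hp).trans hyx.1
  have hsupp : Function.support (c + Pi.single p₀ m) ⊆ insert p₀ (Function.support c) :=
    (Function.support_add _ _).trans (Set.union_subset (Set.subset_insert _ _)
      (Pi.support_single_subset.trans (Set.singleton_subset_iff.2 (Set.mem_insert _ _))))
  refine ⟨c + Pi.single p₀ m, add_nonneg hc (Pi.single_nonneg.2 hm), ?_, fun p hp => ?_, ?_⟩
  · exact (hchain.insert fun p hp _ => Or.inl (he _ _ (hce' p hp))).mono hsupp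
  · rcases hsupp hp with rfl | hp
    exacts [hp₀.subset, (hce' p hp).trans hp₀.subset]
  · rw [map_add, indicatorCombination_single, hcy, hp₀, sub_add_cancel]

end Subdivision

section PosetRealization

/-- The complex of the finite chains of a poset. -/
def chainComplex (P : Type*) [PartialOrder P] : LowerSet (Finset P) where
  carrier := {F | IsChain (· ≤ ·) (F : Set P)}
  lower' _ _ hGF hF := hF.mono (Finset.coe_subset.2 hGF)

theorem posetRealization_eq_realization (P : Type*) [PartialOrder P] [Fintype P] :
    posetRealization P = realization (chainComplex P) := by
  ext w
  have hsupp : (vertexSupport w : Set P) = Function.support w :=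
    Set.ext fun p => mem_vertexSupport
  change _ ↔ w ∈ stdSimplex ℝ P ∧ IsChain (· ≤ ·) (vertexSupport w : Set P)
  rw [hsupp]
  rfl

variable {ι P : Type*} {e : P → Finset ι}

theorem support_div_card (hne : ∀ p, (e p).Nonempty) (w : P → ℝ) :
    (Function.support fun p => w p / ((e p).card : ℝ)) = Function.support w := by
  ext p
  simp [(hne p).ne_empty]

variable [Fintype P]

/-- The affine map which sends the vertex `p` to the barycenter of the face `e p`. -/
noncomputable def subdivisionMap (e : P → Finset ι) (w : P → ℝ) : ι → ℝ :=
  indicatorCombination e fun p => w p / (e p).card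

theorem continuous_subdivisionMap (e : P → Finset ι) : Continuous (subdivisionMap e) :=
  (indicatorCombination e).continuous_of_finiteDimensional.comp
    (continuous_pi fun p => (continuous_apply p).div_const _)

variable [PartialOrder P]

theorem div_card_mem (hne : ∀ p, (e p).Nonempty) {w : P → ℝ} (hw : w ∈ posetRealization P) :
    (0 ≤ fun p => w p / ((e p).card : ℝ)) ∧
      IsChain (· ≤ ·) (Function.support fun p => w p / ((e p).card : ℝ)) :=
  ⟨fun p => div_nonneg (hw.1.1 p) (Nat.cast_nonneg _), (support_div_card hne w).symm ▸ hw.2⟩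

theorem exists_vertexSupport_subdivisionMap_subset [Fintype ι] (he : Antitone e)
    {w : P → ℝ} (hw : w ∈ posetRealization P) : ∃ p, vertexSupport (subdivisionMap e w) ⊆ e p := by
  classical
  have hsupp : (Function.support w).Nonempty := by
    rw [Function.support_nonempty_iff]
    rintro rfl
    simpa using hw.1.2
  obtain ⟨p₀, hp₀⟩ := (Set.toFinite (Function.support w)).exists_minimal hsupp
  refine ⟨p₀, vertexSupport_subset_iff.2 fun i hi => ?_⟩
  rw [subdivisionMap, indicatorCombination_apply]
  refine Finset.sum_eq_zero fun q hq => div_eq_zero_iff.2 (Or.inl ?_)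
  by_contra hwq
  have hle : p₀ ≤ q := (hw.2.total hp₀.prop hwq).elim id (hp₀.le_of_le hwq)
  exact hi (he hle (Finset.mem_filter.1 hq).2)

theorem subdivisionMap_injOn (he : ∀ p q, p ≤ q ↔ e q ⊆ e p) (hne : ∀ p, (e p).Nonempty) :
    (posetRealization P).InjOn (subdivisionMap e) := by
  intro w hw v hv h
  have hwv := indicatorCombination_injOn he hne (div_card_mem hne hw) (div_card_mem hne hv) h
  funext p
  have hcard : ((e p).card : ℝ) ≠ 0 := Nat.cast_ne_zero.2 (hne p).card_ne_zero
  exact (div_left_inj' hcard).1 (congrFun hwv p)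

variable [Fintype ι] {K : LowerSet (Finset ι)}

theorem subdivisionMap_bijOn (he : ∀ p q, p ≤ q ↔ e q ⊆ e p)
    (hK : Set.range e = {F | F ∈ K ∧ F.Nonempty}) :
    (posetRealization P).BijOn (subdivisionMap e) (realization K) := by
  classical
  have hmem (p : P) : e p ∈ K ∧ (e p).Nonempty := hK.subset ⟨p, rfl⟩
  have hne (p : P) : (e p).Nonempty := (hmem p).2
  have hcard (p : P) : ((e p).card : ℝ) ≠ 0 := Nat.cast_ne_zero.2 (hne p).card_ne_zero
  refine ⟨fun w hw => ⟨⟨fun i => ?_, ?_⟩, ?_⟩, subdivisionMap_injOn he hne, fun x hx => ?_⟩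
  · rw [subdivisionMap, indicatorCombination_apply]
    exact Finset.sum_nonneg fun p _ => (div_card_mem hne hw).1 p
  · simp only [subdivisionMap, sum_indicatorCombination, div_mul_cancel₀ _ (hcard _), hw.1.2]
  · obtain ⟨p, hp⟩ := exists_vertexSupport_subdivisionMap_subset (fun p q => (he p q).1) hw
    exact K.lower hp (hmem p).1
  · obtain ⟨c, hc, hchain, -, hcx⟩ := exists_indicatorCombination_eq (fun p q => (he p q).2)
      (fun F hF hFne => hK.superset ⟨hF, hFne⟩) hx.1.1 hx.2
    have hdiv : (fun p => c p * ((e p).card : ℝ) / (e p).card) = c :=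
      funext fun p => mul_div_cancel_right₀ _ (hcard p)
    refine ⟨fun p => c p * (e p).card, ⟨⟨fun p => mul_nonneg (hc p) (Nat.cast_nonneg _), ?_⟩, ?_⟩,
      by rw [subdivisionMap, hdiv, hcx]⟩
    · rw [← sum_indicatorCombination, hcx, hx.1.2]
    · rwa [← support_div_card hne, hdiv]

theorem nonempty_homeomorph_realization (he : ∀ p q, p ≤ q ↔ e q ⊆ e p)
    (hK : Set.range e = {F | F ∈ K ∧ F.Nonempty}) :
    Nonempty (posetRealization P ≃ₜ realization K) := by
  have : CompactSpace (posetRealization P) := isCompact_iff_compactSpace.1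
    (posetRealization_eq_realization P ▸ isCompact_realization _)
  have hbij := subdivisionMap_bijOn he hK
  exact ⟨Continuous.homeoOfEquivCompactToT2 (f := hbij.equiv)
    (((continuous_subdivisionMap e).comp continuous_subtype_val).subtype_mk
      fun w => hbij.mapsTo w.2)⟩

end PosetRealization

/-! ### Regular matroids of vectors -/

section VectorMatroid

variable {K V : Type*} [Field K] [AddCommGroup V] [Module K V]

theorem vectorMatroid_indep_image_val_iff {E : Finset V} {I : Set (vectorMatroid K E).E} :
    (vectorMatroid K E).Indep (Subtype.val '' I) ↔ LinearIndepOn K Subtype.val I := by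
  rw [vectorMatroid_indep_iff, linearIndepOn_iff_image Subtype.val_injective.injOn]
  exact and_iff_right (Subtype.coe_image_subset _ I)

theorem eRank_vectorMatroid (E : Finset V) :
    (vectorMatroid K E).eRank = Module.finrank K (Submodule.span K (E : Set V)) := by
  obtain ⟨B, hB⟩ := (vectorMatroid K E).exists_isBase
  obtain ⟨hBE, hindep⟩ := (vectorMatroid_indep_iff K E B).1 hB.indep
  have hspan : Submodule.span K B = Submodule.span K (E : Set V) := by
    refine le_antisymm (Submodule.span_mono hBE) (Submodule.span_le.2 fun v hv => ?_)
    by_contra hvB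
    refine (hB.insert_dep ⟨hv, fun h => hvB (Submodule.subset_span h)⟩).not_indep ?_
    rw [vectorMatroid_indep_iff]
    exact ⟨Set.insert_subset hv hBE, hindep.insert (by simpa using hvB)⟩
  have := (E.finite_toSet.subset hBE).fintype
  rw [← hB.encard_eq_eRank, ← hspan, finrank_span_set_eq_card hindep,
    Set.encard_eq_coe_toFinset_card]

theorem eRank_vectorMatroid_eq_finrank_iff [FiniteDimensional K V] {E : Finset V} :
    (vectorMatroid K E).eRank = Module.finrank K V ↔ Submodule.span K (E : Set V) = ⊤ := by
  rw [eRank_vectorMatroid, Nat.cast_inj, Submodule.eq_top_iff_finrank_eq]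

end VectorMatroid

section TotallyUnimodular

open Matrix

variable {m n : Type*}

theorem linearIndependent_col_iff_exists_det_submatrix_ne_zero {K : Type*} [Field K] [Finite m]
    [Fintype n] [DecidableEq n] {A : Matrix m n K} :
    LinearIndependent K A.col ↔ ∃ f : n → m, (A.submatrix f id).det ≠ 0 := by
  have isUnit_iff (f : n → m) : IsUnit (A.submatrix f id) ↔ (A.submatrix f id).det ≠ 0 := by
    rw [isUnit_iff_isUnit_det, isUnit_iff_ne_zero]
  constructor
  · intro h
    obtain ⟨κ, a, -, hspan, hrows⟩ := exists_linearIndependent' K A.row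
    have hrank : A.rank = Fintype.card n := by
      rw [rank_eq_finrank_span_cols, finrank_span_eq_card h]
    have htop : Submodule.span K (Set.range (A.row ∘ a)) = ⊤ := by
      rw [hspan, Submodule.eq_top_iff_finrank_eq, ← rank_eq_finrank_span_row, hrank,
        Module.finrank_fintype_fun_eq_card]
    let e : n ≃ κ := (Pi.basisFun K n).indexEquiv (.mk hrows htop.ge)
    refine ⟨a ∘ e, (isUnit_iff _).1 (linearIndependent_rows_iff_isUnit.1 ?_)⟩
    exact hrows.comp e e.injective
  · rintro ⟨f, hf⟩
    exact .of_comp (LinearMap.funLeft K K f)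
      (linearIndependent_cols_iff_isUnit.2 ((isUnit_iff f).2 hf))

theorem isTotallyUnimodular_map_intCast {R : Type*} [CommRing R] {A : Matrix m n ℤ}
    (hA : A.IsTotallyUnimodular) : (A.map (Int.cast : ℤ → R)).IsTotallyUnimodular := by
  intro k f g hf hg
  obtain ⟨s, hs⟩ := hA k f g hf hg
  refine ⟨s, ?_⟩
  rw [submatrix_map, ← Int.cast_det, ← hs, SignType.intCast_cast]

theorem linearIndependent_col_map_intCast_iff_exists_det_ne_zero {K : Type*} [Field K] [Finite m]
    [Fintype n] [DecidableEq n] {A : Matrix m n ℤ} (hA : A.IsTotallyUnimodular) :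
    LinearIndependent K (A.map (Int.cast : ℤ → K)).col ↔
      ∃ f : n → m, (A.submatrix f id).det ≠ 0 := by
  rw [linearIndependent_col_iff_exists_det_submatrix_ne_zero]
  -- The minors are `0` or `±1`, so whether they vanish does not depend on the field.
  refine exists_congr fun f => not_congr ?_
  obtain ⟨s, hs⟩ := (isTotallyUnimodular_iff_fintype A).1 hA n f id
  rw [submatrix_map, ← Int.cast_det, ← hs]
  cases s <;> simp

theorem linearIndepOn_col_map_intCast_iff {K L : Type*} [Field K] [Field L] [Finite m] [Finite n]
    {A : Matrix m n ℤ} (hA : A.IsTotallyUnimodular) {I : Set n} :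
    LinearIndepOn K (A.map (Int.cast : ℤ → K)).col I ↔
      LinearIndepOn L (A.map (Int.cast : ℤ → L)).col I := by
  classical
  have := Fintype.ofFinite I
  have hI := hA.submatrix id (Subtype.val : I → n)
  exact (linearIndependent_col_map_intCast_iff_exists_det_ne_zero hI).trans
    (linearIndependent_col_map_intCast_iff_exists_det_ne_zero hI).symm

theorem exists_forall_ne_eq_zero_of_sum_ne_zero {ι : Type*} [Fintype ι] {a : ι → ℤ}
    (hsign : ∀ i, a i ∈ Set.range SignType.cast) (hinj : Set.InjOn a (Function.support a))
    (hsum : ∑ i, a i ≠ 0) : ∃ i, ∀ j ≠ i, a j = 0 := by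
  have hunit (i : ι) (hi : a i ≠ 0) : a i = 1 ∨ a i = -1 := by
    obtain ⟨s, hs⟩ := hsign i
    rw [← hs] at hi ⊢
    cases s <;> simp_all
  obtain ⟨i, -, hi⟩ := Finset.exists_ne_zero_of_sum_ne_zero hsum
  refine ⟨i, fun j hji => by_contra fun hj => hsum ?_⟩
  have hij : a i ≠ a j := fun h => hji (hinj hj hi h.symm)
  have hrest : ∀ l, l ≠ i ∧ l ≠ j → a l = 0 := fun l hl => by_contra fun hla => by
    have hli : a l ≠ a i := fun h => hl.1 (hinj hla hi h)
    have hlj : a l ≠ a j := fun h => hl.2 (hinj hla hj h)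
    have := hunit i hi
    have := hunit j hj
    have := hunit l hla
    omega
  rw [Fintype.sum_eq_add i j hji.symm hrest]
  have := hunit i hi
  have := hunit j hj
  omega

theorem isTotallyUnimodular_of_col_injOn_support {m n : Type*} {A : Matrix m n ℤ}
    (hentry : ∀ i j, A i j ∈ Set.range SignType.cast)
    (hcol : ∀ j, Set.InjOn (A.col j) (Function.support (A.col j))) : A.IsTotallyUnimodular := by
  intro k
  induction k with
  | zero => exact fun _ _ _ _ => ⟨1, by simp⟩
  | succ k ih =>
    intro f g hf hg
    by_cases hsum : ∀ j, ∑ i, A (f i) (g j) = 0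
    · have hdet : (A.submatrix f g).det = 0 :=
        exists_vecMul_eq_zero_iff.1 ⟨1, one_ne_zero, funext fun j => by
          simpa [vecMul, dotProduct] using hsum j⟩
      exact ⟨0, by simp [hdet]⟩
    · push Not at hsum
      obtain ⟨j, hj⟩ := hsum
      obtain ⟨i, hi⟩ : ∃ i, ∀ i' ≠ i, A (f i') (g j) = 0 := by
        refine exists_forall_ne_eq_zero_of_sum_ne_zero (fun i => hentry (f i) (g j)) ?_ hj
        exact fun i hi i' hi' h => hf (hcol (g j) hi hi' h)
      rw [det_succ_column _ j,
        Finset.sum_eq_single i (fun i' _ hi' => by simp [hi i' hi']) (by simp)]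
      obtain ⟨s, hs⟩ := hentry (f i) (g j)
      obtain ⟨d, hd⟩ := ih (f ∘ i.succAbove) (g ∘ j.succAbove)
        (hf.comp i.succAbove_right_injective) (hg.comp j.succAbove_right_injective)
      refine ⟨(-1) ^ (i + j : ℕ) * s * d, ?_⟩
      rw [submatrix_submatrix, ← hd, submatrix_apply, ← hs]
      simp

end TotallyUnimodular

theorem isRegularMatroid_vectorMatroid_of_isTotallyUnimodular {K V : Type*} [Field K]
    [AddCommGroup V] [Module K V] {E : Finset V} {r : ℕ}
    {A : Matrix (Fin r) (vectorMatroid K E).E ℤ} (hA : A.IsTotallyUnimodular)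
    {g : V →ₗ[K] Fin r → K} (hg : Function.Injective g) (hgA : ∀ x i, g x.1 i = A i x) :
    IsRegularMatroid (vectorMatroid K E) := by
  have hcol : g ∘ Subtype.val = (A.map (Int.cast : ℤ → K)).col := by
    funext x i
    exact hgA x i
  have : Finite (vectorMatroid K E).E := E.finite_toSet
  refine ⟨r, A.map Int.cast, isTotallyUnimodular_map_intCast hA, fun I => ?_⟩
  rw [vectorMatroid_indep_image_val_iff, ← g.linearIndepOn_iff_of_injOn hg.injOn, hcol]
  exact linearIndepOn_col_map_intCast_iff hA

/-! ### The Fano plane -/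

section SpanRepresentation

variable {K L V W J : Type*} [Field K] [Field L] [AddCommGroup V] [Module K V]
  [AddCommGroup W] [Module L W]

theorem mem_span_image_iff_of_linearIndepOn_iff {u : J → V} {c : J → W}
    (h : ∀ I, LinearIndepOn K u I ↔ LinearIndepOn L c I) {I : Set J}
    (hI : LinearIndepOn K u I) (j : J) :
    u j ∈ Submodule.span K (u '' I) ↔ c j ∈ Submodule.span L (c '' I) := by
  by_cases hj : j ∈ I
  · exact iff_of_true (Submodule.subset_span ⟨j, hj, rfl⟩) (Submodule.subset_span ⟨j, hj, rfl⟩)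
  · have hinsert := h (insert j I)
    rw [linearIndepOn_insert hj, linearIndepOn_insert hj, and_iff_right hI,
      and_iff_right ((h I).1 hI)] at hinsert
    exact not_iff_not.1 hinsert

theorem mem_span_singleton_of_add_smul_mem_span_pair {U : Submodule L W} {s d z : W} {r : L}
    (hs : s ∈ U) (hd : d ∈ U) (hz : z ∉ U) (h : s + r • z ∈ Submodule.span L {z, d}) :
    s ∈ Submodule.span L {d} := by
  obtain ⟨a, b, hab⟩ := Submodule.mem_span_pair.1 h
  have hsub : (a - r) • z = s - b • d := by linear_combination (norm := module) hab
  have ha : a - r = 0 := by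
    by_contra ha
    refine hz ((U.smul_mem_iff ha).1 ?_)
    rw [hsub]
    exact U.sub_mem hs (U.smul_mem b hd)
  rw [ha, zero_smul] at hsub
  exact Submodule.mem_span_singleton.2 ⟨b, (sub_eq_zero.1 hsub.symm).symm⟩

theorem span_eq_top_iff_forall_dotProduct {n : Type*} [Fintype n] {S : Set (n → K)} :
    Submodule.span K S = ⊤ ↔ ∀ φ : n → K, φ ≠ 0 → ∃ v ∈ S, φ ⬝ᵥ v ≠ 0 := by
  classical
  rw [← Submodule.dualAnnihilator_eq_bot_iff, Submodule.eq_bot_iff,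
    (dotProductEquiv K n).surjective.forall]
  refine forall_congr' fun φ => ?_
  have hmem : dotProductEquiv K n φ ∈ (Submodule.span K S).dualAnnihilator ↔
      ∀ v ∈ S, φ ⬝ᵥ v = 0 := by
    rw [Submodule.mem_dualAnnihilator]
    exact Submodule.span_le (p := (dotProductEquiv K n φ).ker)
  rw [hmem, map_eq_zero_iff _ (dotProductEquiv K n).injective, ← not_imp_not]
  push Not
  rfl

end SpanRepresentation

section FanoPlane

/-- The seven points of the Fano plane, labelled so that one of its lines is `{0, 1, 6}`. -/
def fanoPoint : Fin 7 → Fin 3 → ZMod 2 :=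
  ![![1, 0, 0], ![0, 1, 1], ![0, 1, 0], ![1, 0, 1], ![1, 1, 0], ![0, 0, 1], ![1, 1, 1]]

theorem fanoPoint_injective : Function.Injective fanoPoint := by decide

theorem fanoPoint_ne_zero (i : Fin 7) : fanoPoint i ≠ 0 := by revert i; decide

theorem exists_fanoPoint_eq : ∀ v : Fin 3 → ZMod 2, v ≠ 0 → ∃ i, fanoPoint i = v := by
  decide +kernel

theorem linearIndepOn_fanoPoint_pair {i j : Fin 7} (hij : i ≠ j) :
    LinearIndepOn (ZMod 2) fanoPoint {i, j} := by
  rw [LinearIndepOn.pair_iff _ hij]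
  revert i j
  decide +kernel

instance (i j k : Fin 7) :
    Decidable (fanoPoint k ∈ Submodule.span (ZMod 2) {fanoPoint i, fanoPoint j}) :=
  decidable_of_iff _ Submodule.mem_span_pair.symm

section FanoConfiguration

variable {L W : Type*} [Field L] [AddCommGroup W] [Module L W] {c : Fin 7 → W}

theorem two_smul_mem_span_pair_of_forall_mem_span_pair_iff
    (hc : ∀ i j k, i ≠ j → (fanoPoint k ∈ Submodule.span (ZMod 2) {fanoPoint i, fanoPoint j} ↔
      c k ∈ Submodule.span L {c i, c j}))
    {p t : L} (h016 : p • c 0 + t • c 1 = c 6) :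
    (2 * p) • c 0 ∈ Submodule.span L {c 4, c 3} := by
  obtain ⟨q, r, h251⟩ := Submodule.mem_span_pair.1 ((hc 2 5 1 (by decide)).1 (by decide +kernel))
  have hc4 : p • c 0 + (t * q) • c 2 ∈ Submodule.span L {c 4} := by
    refine mem_span_singleton_of_add_smul_mem_span_pair (r := t * r)
      (Submodule.mem_span_pair.2 ⟨p, t * q, rfl⟩) ((hc 0 2 4 (by decide)).1 (by decide +kernel))
      ((hc 0 2 5 (by decide)).not.1 (by decide +kernel)) ?_
    convert (hc 5 4 6 (by decide)).1 (by decide +kernel) using 1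
    rw [← h016, ← h251]
    module
  have hc3 : p • c 0 + (t * r) • c 5 ∈ Submodule.span L {c 3} := by
    refine mem_span_singleton_of_add_smul_mem_span_pair (r := t * q)
      (Submodule.mem_span_pair.2 ⟨p, t * r, rfl⟩) ((hc 0 5 3 (by decide)).1 (by decide +kernel))
      ((hc 0 5 2 (by decide)).not.1 (by decide +kernel)) ?_
    convert (hc 2 3 6 (by decide)).1 (by decide +kernel) using 1
    rw [← h016, ← h251]
    module
  have hc1 : c 1 ∈ Submodule.span L {c 4, c 3} := (hc 4 3 1 (by decide)).1 (by decide +kernel)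
  convert sub_mem (add_mem (Submodule.span_mono (by simp) hc4) (Submodule.span_mono (by simp) hc3))
    (Submodule.smul_mem _ t hc1) using 1
  rw [← h251]
  module

theorem two_eq_zero_of_forall_mem_span_pair_iff
    (hc : ∀ i j k, i ≠ j → (fanoPoint k ∈ Submodule.span (ZMod 2) {fanoPoint i, fanoPoint j} ↔
      c k ∈ Submodule.span L {c i, c j})) : (2 : L) = 0 := by
  by_contra htwo
  obtain ⟨p, t, h016⟩ := Submodule.mem_span_pair.1 ((hc 0 1 6 (by decide)).1 (by decide +kernel))
  have hp : p = 0 := by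
    by_contra hp
    refine (hc 4 3 0 (by decide)).not.1 (by decide +kernel) ?_
    exact (Submodule.smul_mem_iff _ (mul_ne_zero htwo hp)).1
      (two_smul_mem_span_pair_of_forall_mem_span_pair_iff hc h016)
  refine (hc 2 5 6 (by decide)).not.1 (by decide +kernel) ?_
  rw [← h016, hp, zero_smul, zero_add]
  exact Submodule.smul_mem _ t ((hc 2 5 1 (by decide)).1 (by decide +kernel))

theorem two_eq_zero_of_forall_linearIndepOn_fanoPoint_iff
    (hc : ∀ I, LinearIndepOn (ZMod 2) fanoPoint I ↔ LinearIndepOn L c I) : (2 : L) = 0 := by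
  refine two_eq_zero_of_forall_mem_span_pair_iff (c := c) fun i j k hij => ?_
  rw [← Set.image_pair, ← Set.image_pair]
  exact mem_span_image_iff_of_linearIndepOn_iff hc (linearIndepOn_fanoPoint_pair hij) k

end FanoConfiguration

theorem IsRegularMatroid.exists_fanoPoint_notMem {E : Finset (Fin 3 → ZMod 2)}
    (h : IsRegularMatroid (vectorMatroid (ZMod 2) E)) : ∃ i, fanoPoint i ∉ E := by
  by_contra! hE
  obtain ⟨m, A, -, hA⟩ := h
  let s (i : Fin 7) : (vectorMatroid (ZMod 2) E).E := ⟨fanoPoint i, hE i⟩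
  have hs : s.Injective := fun i j hij => fanoPoint_injective (congrArg Subtype.val hij)
  refine two_ne_zero (α := ℝ)
    (two_eq_zero_of_forall_linearIndepOn_fanoPoint_iff (c := A.col ∘ s) fun I => ?_)
  have hI := hA (s '' I)
  rw [vectorMatroid_indep_image_val_iff] at hI
  exact ⟨fun h => (hI.1 (.image_of_comp s Subtype.val h)).comp_of_image hs.injOn,
    fun h => (hI.2 (.image_of_comp s A.col h)).comp_of_image hs.injOn⟩

/-! ### Regularity of the spanning sets that miss a point -/

/-- Lifts of the vectors of `F₂³` to `ℤ³`. On the vectors other than `0` and `(1, 1, 1)` they are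
the columns of the oriented incidence matrix of the complete graph on four vertices, with the row
of one vertex removed. -/
def signedLift (x : Fin 3 → ZMod 2) : Fin 3 → ℤ :=
  ![(x 0).val, if x 0 = 0 then (x 1).val else -(x 1).val, -(x 2).val]

theorem intCast_signedLift :
    ∀ (x : Fin 3 → ZMod 2) (i : Fin 3), (signedLift x i : ZMod 2) = x i := by
  decide +kernel

theorem exists_signType_cast_eq_signedLift :
    ∀ (x : Fin 3 → ZMod 2) (i : Fin 3), ∃ s : SignType, (s : ℤ) = signedLift x i := by
  decide +kernel

theorem injOn_support_signedLift {x : Fin 3 → ZMod 2} (hx : x ≠ 1) :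
    Set.InjOn (signedLift x) (Function.support (signedLift x)) := by
  have eq_of_signedLift_eq : ∀ x : Fin 3 → ZMod 2, x ≠ 1 → ∀ i, signedLift x i ≠ 0 →
      ∀ j, signedLift x j ≠ 0 → signedLift x i = signedLift x j → i = j := by
    decide +kernel
  exact fun i hi j hj => eq_of_signedLift_eq x hx i hi j hj

theorem isTotallyUnimodular_signedLift :
    (Matrix.of fun i (x : {x : Fin 3 → ZMod 2 // x ≠ 1}) =>
      signedLift x i).IsTotallyUnimodular :=
  isTotallyUnimodular_of_col_injOn_support (fun i x => exists_signType_cast_eq_signedLift x.1 i)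
    fun x => injOn_support_signedLift x.2

theorem exists_linearEquiv_apply_eq {K V : Type*} [Field K] [AddCommGroup V] [Module K V]
    {x y : V} (hx : x ≠ 0) (hy : y ≠ 0) : ∃ g : V ≃ₗ[K] V, g x = y := by
  obtain ⟨g, hg⟩ := Submodule.exists_linearEquiv_restrict_eq
    (LinearEquiv.coord K V x hx ≪≫ₗ LinearEquiv.toSpanNonzeroSingleton K V y hy)
  refine ⟨g, ?_⟩
  have hgx := hg ⟨x, Submodule.mem_span_singleton_self x⟩
  rw [LinearEquiv.trans_apply, LinearEquiv.coord_self,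
    LinearEquiv.toSpanNonzeroSingleton_one] at hgx
  exact hgx.symm

theorem isRegularMatroid_of_notMem {E : Finset (Fin 3 → ZMod 2)} {v : Fin 3 → ZMod 2}
    (hv : v ≠ 0) (hvE : v ∉ E) : IsRegularMatroid (vectorMatroid (ZMod 2) E) := by
  obtain ⟨g, hg⟩ := exists_linearEquiv_apply_eq (K := ZMod 2) hv one_ne_zero
  let lift (x : (vectorMatroid (ZMod 2) E).E) : {x : Fin 3 → ZMod 2 // x ≠ 1} :=
    ⟨g x.1, fun h => hvE (g.injective (h.trans hg.symm) ▸ x.2)⟩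
  exact isRegularMatroid_vectorMatroid_of_isTotallyUnimodular
    (isTotallyUnimodular_signedLift.submatrix id lift) (g := g.toLinearMap) g.injective
    fun x i => (intCast_signedLift (g x.1) i).symm

end FanoPlane

/-! ### The independence complex of the dual Fano matroid -/

section DualFanoComplex

/-- The independence complex of the dual of the Fano matroid: its faces are the sets of points
whose complement spans `F₂³`. -/
def dualFanoComplex : LowerSet (Finset (Fin 7)) where
  carrier := {F | Submodule.span (ZMod 2) (fanoPoint '' (F : Set (Fin 7))ᶜ) = ⊤}
  lower' F G hGF hF := by
    refine top_unique (hF.ge.trans (Submodule.span_mono (Set.image_mono ?_)))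
    exact Set.compl_subset_compl.2 (Finset.coe_subset.2 hGF)

theorem mem_dualFanoComplex_iff_forall_dotProduct {F : Finset (Fin 7)} :
    F ∈ dualFanoComplex ↔
      ∀ φ : Fin 3 → ZMod 2, φ ≠ 0 → ∃ i, i ∉ F ∧ φ ⬝ᵥ fanoPoint i ≠ 0 := by
  refine span_eq_top_iff_forall_dotProduct.trans (forall₂_congr fun φ _ => ?_)
  simp only [Set.exists_mem_image, Set.mem_compl_iff, Finset.mem_coe]

instance : DecidablePred (· ∈ dualFanoComplex) := fun _ =>
  decidable_of_iff _ mem_dualFanoComplex_iff_forall_dotProduct.symm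

/-- The facets of `dualFanoComplex` that avoid the point `6` and do not contain both of the other
points `0` and `1` of the line `{0, 1, 6}`. -/
def dualFanoFacet : Fin 8 → Finset (Fin 7) :=
  ![{1, 3, 5, 2}, {1, 3, 5, 4}, {1, 2, 4, 3}, {1, 2, 4, 5}, {0, 3, 4, 2}, {0, 3, 4, 5},
    {0, 2, 5, 3}, {0, 2, 5, 4}]

theorem dualFanoFacet_injective : dualFanoFacet.Injective := by decide

theorem card_dualFanoFacet (a : Fin 8) : (dualFanoFacet a).card = 4 := by
  revert a
  decide

theorem maximal_dualFanoFacet (a : Fin 8) : Maximal (· ∈ dualFanoComplex) (dualFanoFacet a) := by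
  have hmem : ∀ a, dualFanoFacet a ∈ dualFanoComplex := by decide +kernel
  have hcard : ∀ F ∈ dualFanoComplex, F.card ≤ 4 := by decide +kernel
  refine ⟨hmem a, fun F hF haF => (Finset.eq_of_subset_of_card_le haF ?_).ge⟩
  exact (hcard F hF).trans (card_dualFanoFacet a).ge

instance : DecidablePred (· ∈ dualFanoComplex.sdiff (Set.range dualFanoFacet)) := fun F =>
  decidable_of_iff (F ∈ dualFanoComplex ∧ ∀ a, ¬ dualFanoFacet a ⊆ F) <| and_congr_right' <| by
    simp only [SetLike.mem_coe, mem_upperClosure, Set.exists_range_iff, not_exists]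

instance {ι : Type*} [DecidableEq ι] (K : LowerSet (Finset ι)) (T : Finset ι)
    [DecidablePred (· ∈ K)] : DecidablePred (· ∈ K.erase T) := fun F =>
  decidable_of_iff (F ∈ K ∧ ¬ T ⊆ F) Iff.rfl

instance contractibleSpace_realization_dualFanoComplex_sdiff :
    ContractibleSpace (realization (dualFanoComplex.sdiff (Set.range dualFanoFacet))) := by
  refine contractibleSpace_realization_of_erase (T := {1, 3, 5}) (v := 0)
    (by decide) (by decide) (by decide +kernel) ?_
  refine contractibleSpace_realization_of_erase (T := {1, 2, 4}) (v := 0)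
    (by decide) (by decide) (by decide +kernel) ?_
  refine contractibleSpace_realization_of_erase (T := {0, 3, 4}) (v := 1)
    (by decide) (by decide) (by decide +kernel) ?_
  refine contractibleSpace_realization_of_erase (T := {0, 2, 5}) (v := 1)
    (by decide) (by decide) (by decide +kernel) ?_
  exact contractibleSpace_realization_of_cone (v := 6)
    ⟨∅, SetLike.mem_coe.2 (by decide +kernel)⟩ (by decide +kernel)

theorem nonempty_homotopyEquiv_realization_dualFanoComplex :
    Nonempty (ContinuousMap.HomotopyEquiv (realization dualFanoComplex) (WedgeOfSpheres 8 3)) :=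
  nonempty_homotopyEquiv_wedge dualFanoFacet_injective maximal_dualFanoFacet
    (n := fun _ => 3) card_dualFanoFacet fun _ => three_ne_zero

end DualFanoComplex

section MissingPoints

/-- The labels of the nonzero vectors of `F₂³` that do not belong to a given set. -/
def missingPoints (E : Finset (Fin 3 → ZMod 2)) : Finset (Fin 7) := {i | fanoPoint i ∉ E}

theorem mem_missingPoints {E : Finset (Fin 3 → ZMod 2)} {i : Fin 7} :
    i ∈ missingPoints E ↔ fanoPoint i ∉ E :=
  Finset.mem_filter_univ i

theorem image_fanoPoint_compl_missingPoints {E : Finset (Fin 3 → ZMod 2)} (hE : 0 ∉ E) :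
    fanoPoint '' (missingPoints E : Set (Fin 7))ᶜ = E := by
  ext v
  constructor
  · rintro ⟨i, hi, rfl⟩
    exact not_not.1 fun h => hi (mem_missingPoints.2 h)
  · intro hv
    obtain ⟨i, rfl⟩ := exists_fanoPoint_eq v (ne_of_mem_of_not_mem hv hE)
    exact ⟨i, fun hi => mem_missingPoints.1 hi hv, rfl⟩

theorem missingPoints_image_fanoPoint_compl (F : Finset (Fin 7)) :
    missingPoints (Fᶜ.image fanoPoint) = F := by
  ext i
  rw [mem_missingPoints, fanoPoint_injective.mem_finset_image, Finset.mem_compl, not_not]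

theorem missingPoints_subset_missingPoints_iff {E F : Finset (Fin 3 → ZMod 2)} (hE : 0 ∉ E)
    (hF : 0 ∉ F) :
    missingPoints F ⊆ missingPoints E ↔ E ⊆ F := by
  rw [← Finset.coe_subset (s₁ := E), ← image_fanoPoint_compl_missingPoints hE,
    ← image_fanoPoint_compl_missingPoints hF, Set.image_subset_image_iff fanoPoint_injective,
    Set.compl_subset_compl, Finset.coe_subset]

theorem missingPoints_mem_dualFanoComplex_iff {E : Finset (Fin 3 → ZMod 2)} (hE : 0 ∉ E) :
    missingPoints E ∈ dualFanoComplex ↔ (vectorMatroid (ZMod 2) E).eRank = 3 := by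
  have hrank := eRank_vectorMatroid_eq_finrank_iff (K := ZMod 2) (E := E)
  rw [Module.finrank_fin_fun, ← image_fanoPoint_compl_missingPoints hE] at hrank
  exact hrank.symm

theorem missingPoints_nonempty_iff {E : Finset (Fin 3 → ZMod 2)} :
    (missingPoints E).Nonempty ↔ IsRegularMatroid (vectorMatroid (ZMod 2) E) := by
  constructor
  · rintro ⟨i, hi⟩
    exact isRegularMatroid_of_notMem (fanoPoint_ne_zero i) (mem_missingPoints.1 hi)
  · intro hE
    obtain ⟨i, hi⟩ := hE.exists_fanoPoint_notMem
    exact ⟨i, mem_missingPoints.2 hi⟩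

theorem range_missingPoints :
    Set.range (fun E : IR 3 => missingPoints E.1) = {F | F ∈ dualFanoComplex ∧ F.Nonempty} := by
  ext F
  constructor
  · rintro ⟨E, rfl⟩
    exact ⟨(missingPoints_mem_dualFanoComplex_iff E.2.1).2 E.2.2.2,
      missingPoints_nonempty_iff.2 E.2.2.1⟩
  · rintro ⟨hF, hne⟩
    have hzero : 0 ∉ Fᶜ.image fanoPoint := by
      simp only [Finset.mem_image, not_exists, not_and]
      exact fun i _ => fanoPoint_ne_zero i
    rw [← missingPoints_image_fanoPoint_compl F] at hF hne
    exact ⟨⟨_, hzero, missingPoints_nonempty_iff.1 hne,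
      (missingPoints_mem_dualFanoComplex_iff hzero).1 hF⟩, missingPoints_image_fanoPoint_compl F⟩

theorem nonempty_homeomorph_realization_dualFanoComplex :
    Nonempty (posetRealization (IR 3) ≃ₜ realization dualFanoComplex) :=
  nonempty_homeomorph_realization
    (fun E F => (missingPoints_subset_missingPoints_iff E.2.1 F.2.1).symm) range_missingPoints

end MissingPoints

theorem mainTheorem2 :
    Nonempty (ContinuousMap.HomotopyEquiv (posetRealization (IR 3)) (WedgeOfSpheres 8 3)) := by
  obtain ⟨subdivision⟩ := nonempty_homeomorph_realization_dualFanoComplex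
  obtain ⟨wedge⟩ := nonempty_homotopyEquiv_realization_dualFanoComplex
  exact ⟨subdivision.toHomotopyEquiv.trans wedge⟩
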